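/- Let $X=(X_t)_{t\ge 0}$ be a Lévy subordinator with Lévy–Khintchine representation $\mathsf E e^{-uX_1}=\exp\big(-bu+\int_0^\infty(e^{-uz}-1)\,\nu(\mathrm dz)\big)$, $u\ge 0$, where $b\ge 0$ and the Lévy measure $\nu$ on $(0,\infty)$ satisfies $\int_0^\infty (z\wedge 1)\,\nu(\mathrm dz)<\infty$. Write $\phi(u)=\mathsf E e^{-uX_1}$. The Blumenthal–Getoor index of a subordinator $W$ with Lévy measure $\nu_W$ is $\mathfrak B(W)=\inf\{p>0:\int_0^1|z|^p\,\nu_W(\mathrm dz)<\infty\}$. For an integer $n\ge 1$, define the regulated $X$-clocks of degree $n$ as follows. (I) Let $\bar X^{(0)}=X$, $\bar X^{(k)}_0=0$ and $\bar X^{(k)}_t=\frac1t\int_0^t\bar X^{(k-1)}_s\,\mathrm ds$ for $t>0$, $k\ge1$; the type-I clock $X^{(n)}$ is a Lévy subordinator with $X^{(n)}_t\overset{d}{=}\bar X^{(n)}_t$ for every $t\ge0$. (II) Let $Y^{(0)}=X$ and, for $1\le k\le n$, let $Y^{(k)}$ be a Lévy subordinator with $Y^{(k)}_0=0$ and $Y^{(k)}_t\overset{d}{=}\frac1t\int_0^t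 Y^{(k-1)}_s\,\mathrm ds$ for every $t>0$; the type-II clock is $Y^{(n)}$. (III) The type-III clock $Z^{(n)}$ is a Lévy subordinator with $Z^{(n)}_0=0$ and $Z^{(n)}_t\overset{d}{=}t^{-n}\int_0^t\cdots\int_0 X_s\,\mathrm ds\cdots\mathrm ds$ ($n$-fold iterated integral) for every $t>0$. For an arbitrary real $n>0$, the regulated clocks of degree $n$ are the Lévy subordinators whose Laplace transforms, for all $t,u\ge0$, are $$\mathsf E e^{-uX^{(n)}_t}=\exp\Big(t\int_0^1\log\phi\Big(\Big(1-\tfrac{\Gamma(n,-\log s)}{\Gamma(n)}\Big)u\Big)\mathrm ds\Big),$$ $$\mathsf E e^{-uY^{(n)}_t}=\exp\Big(\tfrac{t}{\Gamma(n)}\int_0^1(-\log v)^{n-1}\log\phi(uv)\,\mathrm dv\Big),$$ $$\mathsf E e^{-uZ^{(n)}_t}=\exp\Big(t\int_0^1\log\phi\Big(\tfrac{s^n u}{\Gamma(n+1)}\Big)\mathrm ds\Big),$$ where $\Gamma(\cdot,\cdot)$ is the upper incomplete gamma function. Then for every real $n>0$, under either description (the first being available when $n$ is an integer), each of $X^{(n)}$,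 $Y^{(n)}$, $Z^{(n)}$ has a unique Lévy measure, and $$\mathfrak B(X^{(n)})=\mathfrak B(Y^{(n)})=\mathfrak B(Z^{(n)})=\mathfrak B(X).$$ -/

import Mathlib

open MeasureTheory ProbabilityTheory Set Filter Topology
open scoped NNReal ENNReal

universe u v

noncomputable section

namespace RegulatedClock

/-! ## Lévy subordinators and their characteristics -/

/-- A (real-valued) Lévy subordinator: a Lévy process whose sample paths are almost surely
nondecreasing.  (Nondecreasing paths have left limits, so right-continuity gives càdlàg paths.) -/
structure IsLevySubordinator {Ω : Type u} [MeasurableSpace Ω] (P : Measure Ω)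
    (X : ℝ≥0 → Ω → ℝ) : Prop where
  isProbabilityMeasure : IsProbabilityMeasure P
  measurable : ∀ t, Measurable (X t)
  zero : ∀ᵐ ω ∂P, X 0 ω = 0
  indep : HasIndepIncrements X P
  stationary : ∀ s t, IdentDistrib (fun ω => X (s + t) ω - X s ω) (X t) P P
  monotone : ∀ᵐ ω ∂P, Monotone fun t => X t ω
  rightCts : ∀ᵐ ω ∂P, ∀ t, ContinuousWithinAt (fun s => X s ω) (Ici t) t

/-- The Laplace transform `u ↦ E exp (-u Y)` of a random variable. -/
def laplaceTransform {Ω : Type u} [MeasurableSpace Ω] (P : Measure Ω) (Y : Ω → ℝ) (u : ℝ) : ℝ :=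
  ∫ ω, Real.exp (-u * Y ω) ∂P

/-- `X` has drift `b ≥ 0`, no Gaussian part, and Lévy measure `ν` (carried by `(0, ∞)`, with
`∫ (z ∧ 1) ν(dz) < ∞`), in the sense of the Lévy-Khintchine representation
`E exp (-u X₁) = exp (-b u + ∫ (exp (-u z) - 1) ν(dz))` for `u ≥ 0`. -/
structure HasCharacteristics {Ω : Type u} [MeasurableSpace Ω] (P : Measure Ω)
    (X : ℝ≥0 → Ω → ℝ) (b : ℝ) (ν : Measure ℝ) : Prop where
  drift_nonneg : 0 ≤ b
  null : ν (Iic 0) = 0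
  lintegral_lt_top : ∫⁻ z in Ioi 0, ENNReal.ofReal (min z 1) ∂ν < ⊤
  laplace : ∀ u : ℝ, 0 ≤ u → laplaceTransform P (X 1) u =
    Real.exp (-b * u + ∫ z in Ioi 0, (Real.exp (-u * z) - 1) ∂ν)

/-- `ν` is the Lévy measure of the subordinator `X`. -/
def IsLevyMeasure {Ω : Type u} [MeasurableSpace Ω] (P : Measure Ω)
    (X : ℝ≥0 → Ω → ℝ) (ν : Measure ℝ) : Prop :=
  ∃ b : ℝ, HasCharacteristics P X b ν

/-- The Lévy measure of `X`. -/
def levyMeasure {Ω : Type u} [MeasurableSpace Ω] (P : Measure Ω) (X : ℝ≥0 → Ω → ℝ) : Measure ℝ :=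
  Classical.epsilon fun ν : Measure ℝ => IsLevyMeasure P X ν

/-- The Blumenthal-Getoor index of `X`: the infimum of all `p > 0` with
`∫₀¹ |z|^p ν(dz) < ∞`, where `ν` is the Lévy measure of `X`. -/
def blumenthalGetoorIndex {Ω : Type u} [MeasurableSpace Ω] (P : Measure Ω)
    (X : ℝ≥0 → Ω → ℝ) : ℝ :=
  sInf {p : ℝ | 0 < p ∧ ∫⁻ z in Ioc 0 1, ENNReal.ofReal (|z| ^ p) ∂(levyMeasure P X) < ⊤}

/-! ## The three recipes -/

/-- The running average `t ↦ t⁻¹ ∫₀ᵗ X_s ds`, with value `0` at `t = 0`. -/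
def runningAverage {Ω : Type u} (X : ℝ≥0 → Ω → ℝ) (t : ℝ≥0) (ω : Ω) : ℝ :=
  (t : ℝ)⁻¹ * ∫ s in (0 : ℝ)..t, X s.toNNReal ω

/-- The `k`-times repeated running average of `X`. -/
def repeatedAverage {Ω : Type u} (X : ℝ≥0 → Ω → ℝ) : ℕ → ℝ≥0 → Ω → ℝ
  | 0 => X
  | k + 1 => runningAverage (repeatedAverage X k)

/-- The `k`-fold iterated integral `∫₀ᵗ ⋯ ∫₀ X_s ds ⋯ ds`. -/
def iteratedIntegral {Ω : Type u} (X : ℝ≥0 → Ω → ℝ) : ℕ → ℝ≥0 → Ω → ℝ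
  | 0 => X
  | k + 1 => fun t ω => ∫ s in (0 : ℝ)..t, iteratedIntegral X k s.toNNReal ω

/-- The quasi-average `t ↦ t^{-k} ∫₀ᵗ ⋯ ∫₀ X_s ds ⋯ ds` (`k` integrals). -/
def quasiAverage {Ω : Type u} (X : ℝ≥0 → Ω → ℝ) (k : ℕ) (t : ℝ≥0) (ω : Ω) : ℝ :=
  ((t : ℝ) ^ k)⁻¹ * iteratedIntegral X k t ω

/-- `W` is a Lévy subordinator induced by the process `A`: for each fixed time `t`,
the variables `W_t` and `A_t` have the same distribution. -/
structure IsInducedBy {Ω : Type u} {Ω' : Type v} [MeasurableSpace Ω] [MeasurableSpace Ω']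
    (P : Measure Ω) (A : ℝ≥0 → Ω → ℝ) (P' : Measure Ω') (W : ℝ≥0 → Ω' → ℝ) : Prop where
  isLevySubordinator : IsLevySubordinator P' W
  identDistrib : ∀ t, IdentDistrib (W t) (A t) P' P

/-- Second recipe: `W` is obtained from `X` by `k ≥ 1` rounds of "take the running average, then
pass to an induced Lévy subordinator". -/
inductive IsAveragedInduced {Ω : Type u} [MeasurableSpace Ω] (P : Measure Ω) (X : ℝ≥0 → Ω → ℝ) :
    ℕ → ∀ {Ω' : Type v} [MeasurableSpace Ω'], Measure Ω' → (ℝ≥0 → Ω' → ℝ) → Prop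
  | one {Ω' : Type v} [MeasurableSpace Ω'] (P' : Measure Ω') (W : ℝ≥0 → Ω' → ℝ)
      (h : IsInducedBy P (runningAverage X) P' W) : IsAveragedInduced P X 1 P' W
  | succ (k : ℕ) {Ω' Ω'' : Type v} [MeasurableSpace Ω'] [MeasurableSpace Ω'']
      (P' : Measure Ω') (Y : ℝ≥0 → Ω' → ℝ) (P'' : Measure Ω'') (W : ℝ≥0 → Ω'' → ℝ)
      (hY : IsAveragedInduced P X k P' Y)
      (h : IsInducedBy P' (runningAverage Y) P'' W) : IsAveragedInduced P X (k + 1) P'' W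

/-- The upper incomplete gamma function `Γ(a, x) = ∫ₓ^∞ r^{a-1} e^{-r} dr`. -/
def upperGamma (a x : ℝ) : ℝ := ∫ r in Ioi x, r ^ (a - 1) * Real.exp (-r)

/-- The logarithm `log E exp (-u X₁)` of the Laplace transform of `X₁`. -/
def logLaplace {Ω : Type u} [MeasurableSpace Ω] (P : Measure Ω) (X : ℝ≥0 → Ω → ℝ) (u : ℝ) : ℝ :=
  Real.log (laplaceTransform P (X 1) u)

/-- `W` is a type-I regulated `X`-clock of degree `n`.  For an integer degree it is induced by the
`n`-times repeated running average of `X`; for a general real degree it is the Lévy subordinator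
given by the extension to real `n` of the Laplace transforms found for integer degrees. -/
structure IsTypeIClock {Ω : Type u} {Ω' : Type v} [MeasurableSpace Ω] [MeasurableSpace Ω']
    (P : Measure Ω) (X : ℝ≥0 → Ω → ℝ) (n : ℝ) (P' : Measure Ω') (W : ℝ≥0 → Ω' → ℝ) : Prop where
  isLevySubordinator : IsLevySubordinator P' W
  regulated :
    (∃ k : ℕ, 1 ≤ k ∧ n = k ∧ IsInducedBy P (repeatedAverage X k) P' W) ∨
    (∀ t : ℝ≥0, ∀ u : ℝ, 0 ≤ u → laplaceTransform P' (W t) u =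
      Real.exp (t * ∫ s in (0 : ℝ)..1,
        logLaplace P X ((1 - upperGamma n (-Real.log s) / Real.Gamma n) * u)))

/-- `W` is a type-II regulated `X`-clock of degree `n`.  For an integer degree it arises from
`n` rounds of averaging and inducing; for a general real degree it is the Lévy subordinator
given by the extension to real `n` of the Laplace transforms found for integer degrees. -/
structure IsTypeIIClock {Ω : Type u} {Ω' : Type v} [MeasurableSpace Ω] [MeasurableSpace Ω']
    (P : Measure Ω) (X : ℝ≥0 → Ω → ℝ) (n : ℝ) (P' : Measure Ω') (W : ℝ≥0 → Ω' → ℝ) : Prop where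
  isLevySubordinator : IsLevySubordinator P' W
  regulated :
    (∃ k : ℕ, 1 ≤ k ∧ n = k ∧ IsAveragedInduced P X k P' W) ∨
    (∀ t : ℝ≥0, ∀ u : ℝ, 0 ≤ u → laplaceTransform P' (W t) u =
      Real.exp (t / Real.Gamma n * ∫ s in (0 : ℝ)..1,
        (-Real.log s) ^ (n - 1) * logLaplace P X (u * s)))

/-- `W` is a type-III regulated `X`-clock of degree `n`.  For an integer degree it is induced by
the quasi-average of `X` with `n` integrals; for a general real degree it is the Lévy subordinator
given by the extension to real `n` of the Laplace transforms found for integer degrees. -/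
structure IsTypeIIIClock {Ω : Type u} {Ω' : Type v} [MeasurableSpace Ω] [MeasurableSpace Ω']
    (P : Measure Ω) (X : ℝ≥0 → Ω → ℝ) (n : ℝ) (P' : Measure Ω') (W : ℝ≥0 → Ω' → ℝ) : Prop where
  isLevySubordinator : IsLevySubordinator P' W
  regulated :
    (∃ k : ℕ, 1 ≤ k ∧ n = k ∧ IsInducedBy P (quasiAverage X k) P' W) ∨
    (∀ t : ℝ≥0, ∀ u : ℝ, 0 ≤ u → laplaceTransform P' (W t) u =
      Real.exp (t * ∫ s in (0 : ℝ)..1,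
        logLaplace P X (s ^ n * u / Real.Gamma (n + 1))))

end RegulatedClock

end

namespace RegulatedClock

/-! Write ψ for `logLaplace` of X. Under every description, the exponent of the clock at time 1 is
reached through mixtures ∫ ψ(r u) m(dr), with m a nonzero finite measure on some (0, C]. By Fubini
such a W has Lévy measure equal to the image of m ⊗ ν under multiplication
(`HasCharacteristics.mulMixture`). Bounded random rescaling of jumps does not affect which p-th
powers are integrable near 0: the factors are bounded above, a positive mass of them is bounded away
from 0, and ν is finite away from 0 (`lintegral_rpow_mulMixture_lt_top_iff`). Hence the indices
agree.

For the explicit Laplace transforms, m can be read off: the law of a function of a uniform variable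
for types I and III, a density for type II. For the recipes, an iterated average at time 1 is a
pathwise integral ∫ X_r m(dr) with m on (0, 1]. Approximating by weighted sums of independent
increments gives it the exponent ∫₀¹ ψ(m(s, ∞) u) ds
(`IsLevySubordinator.laplaceTransform_integral`), again a mixture over a uniform variable. Type II
repeats the one-step case inductively.

The index is well defined because the Lévy measure is unique (`HasCharacteristics.measure_unique`):
a second difference of ψ removes the drift and leaves the Laplace transform of a finite measure
equivalent to ν. -/

/-! ### Finite measures on the half-line and their Laplace transforms -/

lemma Iic_subset_integrableExpSet_id {μ : Measure ℝ} [IsFiniteMeasure μ] (hμ : μ (Iio 0) = 0) :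
    Iic 0 ⊆ integrableExpSet id μ := by
  intro t ht
  have h0 : ∀ᵐ z ∂μ, 0 ≤ z := by
    have : ∀ᵐ z ∂μ, z ∉ Iio (0 : ℝ) := measure_eq_zero_iff_ae_notMem.1 hμ
    filter_upwards [this] with z hz
    simpa using hz
  refine (integrable_const (1 : ℝ)).mono' (by fun_prop) ?_
  filter_upwards [h0] with z hz
  rw [Real.norm_eq_abs, abs_of_pos (Real.exp_pos _), Real.exp_le_one_iff]
  exact mul_nonpos_of_nonpos_of_nonneg ht hz

/-- Identity theorem: both sides are analytic on the open left half-plane and agree at negative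
reals, which accumulate at -1. -/
lemma complexMGF_eq_of_laplace_eq {μ μ' : Measure ℝ} [IsFiniteMeasure μ] [IsFiniteMeasure μ']
    (hμ : μ (Iio 0) = 0) (hμ' : μ' (Iio 0) = 0)
    (h : ∀ u : ℝ, 0 ≤ u → ∫ z, Real.exp (-u * z) ∂μ = ∫ z, Real.exp (-u * z) ∂μ') :
    EqOn (complexMGF id μ) (complexMGF id μ') {z : ℂ | z.re < 0} := by
  have hint : ∀ {ρ : Measure ℝ} [IsFiniteMeasure ρ], ρ (Iio 0) = 0 →
      AnalyticOnNhd ℂ (complexMGF id ρ) {z : ℂ | z.re < 0} := fun hρ =>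
    analyticOnNhd_complexMGF.mono fun z (hz : z.re < 0) =>
      interior_mono (Iic_subset_integrableExpSet_id hρ) (by simpa using hz)
  have hpre : IsPreconnected {z : ℂ | z.re < 0} := (convex_halfSpace_re_lt 0).isPreconnected
  refine (hint hμ).eqOn_of_preconnected_of_frequently_eq (hint hμ') hpre
    (z₀ := ((-1 : ℝ) : ℂ)) (by simp) ?_
  have hreal : ∃ᶠ x : ℝ in 𝓝[≠] (-1), complexMGF id μ x = complexMGF id μ' x := by
    refine Eventually.frequently ?_
    have : ∀ᶠ x : ℝ in 𝓝[≠] (-1), x < 0 :=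
      eventually_nhdsWithin_of_eventually_nhds (eventually_lt_nhds (by norm_num))
    filter_upwards [this] with x hx
    rw [complexMGF_ofReal, complexMGF_ofReal]
    have := h (-x) (by linarith)
    simp only [neg_neg] at this
    simp only [mgf, id]
    rw [this]
  rw [frequently_iff_seq_forall] at hreal ⊢
  obtain ⟨xs, hx, hxe⟩ := hreal
  refine ⟨fun n => xs n, ?_, hxe⟩
  rw [tendsto_nhdsWithin_iff] at hx ⊢
  refine ⟨(Complex.continuous_ofReal.tendsto _).comp hx.1, ?_⟩
  filter_upwards [hx.2] with n hn
  exact fun hc => hn (Complex.ofReal_injective hc)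

/-- A finite measure on `[0, ∞)` is determined by its Laplace transform. -/
theorem ext_of_laplace_eq {μ μ' : Measure ℝ} [IsFiniteMeasure μ] [IsFiniteMeasure μ']
    (hμ : μ (Iio 0) = 0) (hμ' : μ' (Iio 0) = 0)
    (h : ∀ u : ℝ, 0 ≤ u → ∫ z, Real.exp (-u * z) ∂μ = ∫ z, Real.exp (-u * z) ∂μ') : μ = μ' := by
  have heq := complexMGF_eq_of_laplace_eq hμ hμ' h
  -- Equality is known only for Re z < 0, while characteristic functions live on the boundary Re z =
  -- 0. Tilting by exp(-z) moves them to the line Re z = -1; the tilt is undone at the end, its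
  -- density being positive and finite.
  let w : ℝ → ℝ≥0∞ := fun z => ENNReal.ofReal (Real.exp (-z))
  have hw : Measurable w := by fun_prop
  have hw0 : ∀ z, w z ≠ 0 := fun z => by simp [w, Real.exp_pos]
  have hwt : ∀ z, w z ≠ ⊤ := fun z => by simp [w]
  have hfin : ∀ {ρ : Measure ℝ} [IsFiniteMeasure ρ], ρ (Iio 0) = 0 →
      IsFiniteMeasure (ρ.withDensity w) := fun {ρ} _ hρ => by
    have := (Iic_subset_integrableExpSet_id hρ) (show (-1 : ℝ) ∈ Iic 0 by simp)
    refine isFiniteMeasure_withDensity_ofReal (f := fun z => Real.exp (-z)) ?_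
    simpa [integrableExpSet] using this.2
  have := hfin hμ
  have := hfin hμ'
  have key : μ.withDensity w = μ'.withDensity w := by
    refine Measure.ext_of_charFun ?_
    ext t
    have hc : ∀ ρ : Measure ℝ, charFun (ρ.withDensity w) t =
        complexMGF id ρ (-1 + t * Complex.I) := fun ρ => by
      rw [charFun_apply_real, integral_withDensity_eq_integral_toReal_smul hw
        (.of_forall fun z => (hwt z).lt_top), complexMGF]
      refine integral_congr_ae (.of_forall fun z => ?_)
      simp only [w, ENNReal.toReal_ofReal (Real.exp_pos _).le, id, Complex.real_smul,
        Complex.ofReal_exp, ← Complex.exp_add]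
      congr 1
      push_cast
      ring
    rw [hc, hc]
    exact heq (by simp)
  rw [← withDensity_inv_same (μ := μ) hw (.of_forall hw0) (.of_forall hwt), key,
    withDensity_inv_same hw (.of_forall hw0) (.of_forall hwt)]

/-! ### Integrability against a Lévy measure, and its uniqueness -/

section Characteristics

variable {Ω : Type u} [MeasurableSpace Ω] {P : Measure Ω} {X : ℝ≥0 → Ω → ℝ} {b : ℝ}
  {ν : Measure ℝ}

lemma HasCharacteristics.ae_pos (h : HasCharacteristics P X b ν) : ∀ᵐ z ∂ν, 0 < z := by
  have : ∀ᵐ z ∂ν, z ∉ Iic (0 : ℝ) := measure_eq_zero_iff_ae_notMem.1 h.null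
  filter_upwards [this] with z hz
  simpa using hz

lemma HasCharacteristics.restrict_eq (h : HasCharacteristics P X b ν) :
    ν.restrict (Ioi 0) = ν :=
  Measure.restrict_eq_self_of_ae_mem h.ae_pos

lemma HasCharacteristics.integrable_min (h : HasCharacteristics P X b ν) :
    Integrable (fun z : ℝ => min z 1) ν := by
  have := h.lintegral_lt_top
  rw [h.restrict_eq] at this
  refine ⟨by fun_prop, ?_⟩
  rw [hasFiniteIntegral_iff_ofReal (h.ae_pos.mono fun z hz => le_min hz.le zero_le_one)]
  exact this

lemma abs_exp_neg_sub_one_le {u z : ℝ} (hu : 0 ≤ u) (hz : 0 ≤ z) :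
    |Real.exp (-u * z) - 1| ≤ max u 1 * min z 1 := by
  have h1 : Real.exp (-u * z) ≤ 1 := Real.exp_le_one_iff.2 (by nlinarith)
  rw [abs_of_nonpos (by linarith)]
  have h2 := Real.add_one_le_exp (-u * z)
  have h3 := Real.exp_pos (-u * z)
  rcases le_total z 1 with hz1 | hz1
  · rw [min_eq_left hz1]
    nlinarith [le_max_left u 1]
  · rw [min_eq_right hz1]
    linarith [le_max_right u 1]

lemma HasCharacteristics.integrable_exp_sub_one (h : HasCharacteristics P X b ν) {u : ℝ}
    (hu : 0 ≤ u) : Integrable (fun z : ℝ => Real.exp (-u * z) - 1) ν := by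
  refine (h.integrable_min.const_mul (max u 1)).mono' (by fun_prop) ?_
  filter_upwards [h.ae_pos] with z hz
  exact abs_exp_neg_sub_one_le hu hz.le

lemma HasCharacteristics.logLaplace_eq (h : HasCharacteristics P X b ν) {u : ℝ} (hu : 0 ≤ u) :
    logLaplace P X u = -b * u + ∫ z, (Real.exp (-u * z) - 1) ∂ν := by
  rw [logLaplace, h.laplace u hu, Real.log_exp, h.restrict_eq]

lemma HasCharacteristics.laplaceTransform_eq (h : HasCharacteristics P X b ν) {u : ℝ}
    (hu : 0 ≤ u) : laplaceTransform P (X 1) u = Real.exp (logLaplace P X u) := by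
  rw [logLaplace, h.laplace u hu, Real.log_exp]

lemma HasCharacteristics.integrable_sq (h : HasCharacteristics P X b ν) :
    Integrable (fun z : ℝ => (1 - Real.exp (-z)) ^ 2) ν := by
  refine (h.integrable_min).mono' (by fun_prop) ?_
  filter_upwards [h.ae_pos] with z hz
  have := abs_exp_neg_sub_one_le zero_le_one hz.le
  rw [abs_sub_comm] at this
  simp only [neg_mul, one_mul, max_self] at this
  have h1 : |1 - Real.exp (-z)| ≤ 1 := this.trans (min_le_right _ _)
  rw [Real.norm_eq_abs, abs_pow]
  nlinarith [abs_nonneg (1 - Real.exp (-z))]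

/-- The drift term is linear in u and the integrand's -1 is constant, so both cancel in a second
difference. A first difference would retain the drift. -/
lemma HasCharacteristics.second_difference (h : HasCharacteristics P X b ν) {u : ℝ}
    (hu : 0 ≤ u) :
    ∫ z, Real.exp (-u * z) * (1 - Real.exp (-z)) ^ 2 ∂ν =
      logLaplace P X (u + 2) - 2 * logLaplace P X (u + 1) + logLaplace P X u := by
  rw [h.logLaplace_eq hu, h.logLaplace_eq (by linarith : 0 ≤ u + 1),
    h.logLaplace_eq (by linarith : 0 ≤ u + 2)]
  have i0 := h.integrable_exp_sub_one hu
  have i1 := h.integrable_exp_sub_one (by linarith : 0 ≤ u + 1)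
  have i2 := h.integrable_exp_sub_one (by linarith : 0 ≤ u + 2)
  have : ∫ z, Real.exp (-u * z) * (1 - Real.exp (-z)) ^ 2 ∂ν =
      ∫ z, ((Real.exp (-(u + 2) * z) - 1) - 2 * (Real.exp (-(u + 1) * z) - 1)) +
        (Real.exp (-u * z) - 1) ∂ν := by
    congr 1
    ext z
    rw [show -(u + 2) * z = -u * z + -z + -z by ring, show -(u + 1) * z = -u * z + -z by ring,
      Real.exp_add, Real.exp_add]
    ring
  have i21 : Integrable (fun z : ℝ => (Real.exp (-(u + 2) * z) - 1) -
      2 * (Real.exp (-(u + 1) * z) - 1)) ν := i2.sub (i1.const_mul 2)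
  rw [this, integral_add i21 i0, integral_sub i2 (i1.const_mul 2), integral_const_mul]
  ring

/-- The Lévy measure of a subordinator is unique. -/
theorem HasCharacteristics.measure_unique {b' : ℝ} {ν' : Measure ℝ}
    (h : HasCharacteristics P X b ν) (h' : HasCharacteristics P X b' ν') : ν = ν' := by
  -- The weight of the second difference: it makes the measure finite and is nonzero on z > 0, so it
  -- can be divided out again.
  let w : ℝ → ℝ≥0∞ := fun z => ENNReal.ofReal ((1 - Real.exp (-z)) ^ 2)
  have hw : Measurable w := by fun_prop
  have hwt : ∀ z, w z ≠ ⊤ := fun z => by simp [w]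
  have main : ∀ {b : ℝ} {ρ : Measure ℝ}, HasCharacteristics P X b ρ →
      (∀ᵐ z ∂ρ, w z ≠ 0) ∧ IsFiniteMeasure (ρ.withDensity w) ∧ (ρ.withDensity w) (Iio 0) = 0 ∧
      ∀ u : ℝ, 0 ≤ u → ∫ z, Real.exp (-u * z) ∂(ρ.withDensity w) =
        logLaplace P X (u + 2) - 2 * logLaplace P X (u + 1) + logLaplace P X u := by
    intro b ρ hρ
    refine ⟨?_, isFiniteMeasure_withDensity_ofReal hρ.integrable_sq.2, ?_, fun u hu => ?_⟩
    · filter_upwards [hρ.ae_pos] with z hz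
      have : Real.exp (-z) < 1 := Real.exp_lt_one_iff.2 (by linarith)
      have h2 : 0 < (1 - Real.exp (-z)) ^ 2 := by
        have : 0 < 1 - Real.exp (-z) := by linarith
        positivity
      exact (ENNReal.ofReal_pos.2 h2).ne'
    · exact withDensity_absolutelyContinuous _ _
        (measure_mono_null Iio_subset_Iic_self hρ.null)
    · rw [integral_withDensity_eq_integral_toReal_smul hw
        (.of_forall fun z => (hwt z).lt_top), ← hρ.second_difference hu]
      refine integral_congr_ae (.of_forall fun z => ?_)
      simp only [w, ENNReal.toReal_ofReal (sq_nonneg _), smul_eq_mul]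
      ring
  obtain ⟨n1, f1, z1, e1⟩ := main h
  obtain ⟨n2, f2, z2, e2⟩ := main h'
  have key := ext_of_laplace_eq z1 z2 fun u hu => (e1 u hu).trans (e2 u hu).symm
  rw [← withDensity_inv_same (μ := ν) hw n1 (.of_forall hwt), key,
    withDensity_inv_same hw n2 (.of_forall hwt)]

/-- The epsilon choice returns some Lévy measure, and uniqueness leaves only one candidate. -/
lemma HasCharacteristics.levyMeasure_eq (h : HasCharacteristics P X b ν) :
    levyMeasure P X = ν := by
  obtain ⟨b', h'⟩ : IsLevyMeasure P X (levyMeasure P X) :=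
    Classical.epsilon_spec (p := fun ν : Measure ℝ => IsLevyMeasure P X ν) ⟨ν, b, h⟩
  exact h'.measure_unique h

lemma HasCharacteristics.existsUnique (h : HasCharacteristics P X b ν) :
    ∃! ν' : Measure ℝ, IsLevyMeasure P X ν' :=
  ⟨ν, ⟨b, h⟩, fun _ ⟨_, h'⟩ => h'.measure_unique h⟩

lemma HasCharacteristics.measure_Ioi_lt_top (h : HasCharacteristics P X b ν) {δ : ℝ}
    (hδ : 0 < δ) : ν (Ioi δ) < ⊤ := by
  refine lt_of_le_of_lt (measure_mono fun z hz => ?_)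
    (h.integrable_min.measure_ge_lt_top (ε := min δ 1) (by positivity))
  exact min_le_min_right _ (le_of_lt (mem_Ioi.1 hz))

/-- Needed for Fubini on m ⊗ ν. The null half-line is added to each set only to cover the whole real
line. -/
lemma HasCharacteristics.sigmaFinite (h : HasCharacteristics P X b ν) : SigmaFinite ν := by
  refine ⟨⟨⟨fun n => Iic 0 ∪ Ioi ((n : ℝ) + 1)⁻¹, fun _ => trivial, fun n => ?_, ?_⟩⟩⟩
  · refine (measure_union_le _ _).trans_lt ?_
    rw [h.null, zero_add]
    exact h.measure_Ioi_lt_top (by positivity)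
  · refine eq_univ_of_forall fun z => mem_iUnion.2 ?_
    rcases le_or_gt z 0 with hz | hz
    · exact ⟨0, Or.inl hz⟩
    · obtain ⟨n, hn⟩ := exists_nat_one_div_lt hz
      exact ⟨n, Or.inr (by simpa using hn)⟩

end Characteristics

/-! ### Multiplicative mixtures and power integrals over small jumps -/

/-- The law of the product of a factor with law `m` and a jump size with law `ν`. -/
noncomputable def mulMixture (m ν : Measure ℝ) : Measure ℝ :=
  (m.prod ν).map fun p : ℝ × ℝ => p.1 * p.2

lemma exists_measure_Ioi_ne_zero {m : Measure ℝ} (hm : ∀ᵐ r ∂m, 0 < r) (hm0 : m ≠ 0) :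
    ∃ c : ℝ, 0 < c ∧ m (Ioi c) ≠ 0 := by
  by_contra! hcon
  refine hm0 (Measure.measure_univ_eq_zero.1 (measure_eq_zero_iff_ae_notMem.2 ?_))
  have h1 : ∀ n : ℕ, ∀ᵐ r ∂m, r ∉ Ioi ((n : ℝ) + 1)⁻¹ := fun n =>
    measure_eq_zero_iff_ae_notMem.1 (hcon _ (by positivity))
  filter_upwards [hm, ae_all_iff.2 h1] with r hr hr2
  obtain ⟨n, hn⟩ := exists_nat_one_div_lt hr
  exact absurd (by simpa using hn) (hr2 n)

section Mixture

variable {m ν : Measure ℝ} [SigmaFinite ν] {C : ℝ}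

lemma lintegral_mulMixture {f : ℝ → ℝ≥0∞} (hf : Measurable f) :
    ∫⁻ z, f z ∂(mulMixture m ν) = ∫⁻ r, ∫⁻ z, f (r * z) ∂ν ∂m := by
  rw [mulMixture, lintegral_map hf (by fun_prop), lintegral_prod _ (by fun_prop)]

lemma mulMixture_Iic (hm : ∀ᵐ r ∂m, 0 < r ∧ r ≤ C) (hν : ∀ᵐ z ∂ν, 0 < z) :
    mulMixture m ν (Iic 0) = 0 := by
  rw [← lintegral_indicator_one measurableSet_Iic,
    lintegral_mulMixture (measurable_one.indicator measurableSet_Iic)]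
  rw [lintegral_congr_ae (g := fun _ => 0), lintegral_zero]
  filter_upwards [hm] with r hr
  rw [lintegral_congr_ae (g := fun _ => 0), lintegral_zero]
  filter_upwards [hν] with z hz
  refine indicator_of_notMem ?_ _
  simpa using mul_pos hr.1 hz

/-- For 0 < r ≤ C one has min(rz, 1) ≤ max(C, 1) · min(z, 1). -/
lemma lintegral_min_mulMixture_lt_top [IsFiniteMeasure m]
    (hm : ∀ᵐ r ∂m, 0 < r ∧ r ≤ C) (hν : ∀ᵐ z ∂ν, 0 < z)
    (h : ∫⁻ z, ENNReal.ofReal (min z 1) ∂ν < ⊤) :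
    ∫⁻ z, ENNReal.ofReal (min z 1) ∂(mulMixture m ν) < ⊤ := by
  rw [lintegral_mulMixture (by fun_prop)]
  refine lt_of_le_of_lt (b := ∫⁻ _, ENNReal.ofReal (max C 1) *
    ∫⁻ z, ENNReal.ofReal (min z 1) ∂ν ∂m) ?_ ?_
  · refine lintegral_mono_ae ?_
    filter_upwards [hm] with r hr
    rw [← lintegral_const_mul _ (by fun_prop)]
    refine lintegral_mono_ae ?_
    filter_upwards [hν] with z hz
    rw [← ENNReal.ofReal_mul (by positivity)]
    refine ENNReal.ofReal_le_ofReal ?_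
    have h1 : r ≤ max C 1 := hr.2.trans (le_max_left _ _)
    have h2 : 1 ≤ max C 1 := le_max_right _ _
    rcases le_total z 1 with hz1 | hz1
    · rw [min_eq_left hz1]
      exact (min_le_left _ _).trans (mul_le_mul_of_nonneg_right h1 hz.le)
    · rw [min_eq_right hz1, mul_one]
      exact (min_le_right _ _).trans h2
  · rw [lintegral_const]
    exact ENNReal.mul_lt_top (ENNReal.mul_lt_top ENNReal.ofReal_lt_top h) (measure_lt_top _ _)

/-- The power integrals over the small jumps are finite simultaneously for `ν` and for its
mixture by factors in `(0, C]`. -/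
lemma lintegral_rpow_mulMixture_lt_top_iff [IsFiniteMeasure m]
    (hm : ∀ᵐ r ∂m, 0 < r ∧ r ≤ C) (hm0 : m ≠ 0)
    (hν : ∀ᵐ z ∂ν, 0 < z) (htail : ∀ δ : ℝ, 0 < δ → ν (Ioi δ) < ⊤) {p : ℝ} (hp : 0 < p) :
    ∫⁻ z in Ioc 0 1, ENNReal.ofReal (|z| ^ p) ∂(mulMixture m ν) < ⊤ ↔
      ∫⁻ z in Ioc 0 1, ENNReal.ofReal (|z| ^ p) ∂ν < ⊤ := by
  have hmeas : Measurable fun z : ℝ => ENNReal.ofReal (|z| ^ p) := by fun_prop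
  rw [← lintegral_indicator measurableSet_Ioc (μ := mulMixture m ν),
    lintegral_mulMixture (hmeas.indicator measurableSet_Ioc)]
  have hD1 : (1 : ℝ) ≤ max C 1 := le_max_right _ _
  have hD0 : (0 : ℝ) < max C 1 := by positivity
  constructor
  · intro h
    obtain ⟨c, hc, hmc⟩ := exists_measure_Ioi_ne_zero (hm.mono fun r hr => hr.1) hm0
    -- Keep only factors r > c, a set of positive mass. The bound z ≤ 1 / max(C, 1) forces rz ≤ 1,
    -- so (cz)^p is dominated by the mixture's integrand.
    have hsmall : ∫⁻ z in Ioc 0 (max C 1)⁻¹, ENNReal.ofReal (|z| ^ p) ∂ν < ⊤ := by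
      have hle : m (Ioi c) * (ENNReal.ofReal (c ^ p) *
          ∫⁻ z in Ioc 0 (max C 1)⁻¹, ENNReal.ofReal (|z| ^ p) ∂ν) < ⊤ := by
        refine lt_of_le_of_lt ?_ h
        rw [mul_comm, ← setLIntegral_const, ← lintegral_indicator measurableSet_Ioi]
        refine lintegral_mono_ae ?_
        filter_upwards [hm] with r hr
        by_cases hrc : r ∈ Ioi c
        swap
        · simp [indicator_of_notMem hrc]
        rw [indicator_of_mem hrc, ← lintegral_const_mul _ hmeas,
          ← lintegral_indicator measurableSet_Ioc]
        refine lintegral_mono fun z => ?_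
        by_cases hz : z ∈ Ioc 0 (max C 1)⁻¹
        swap
        · simp [indicator_of_notMem hz]
        have hrz : r * z ∈ Ioc (0 : ℝ) 1 := by
          refine ⟨mul_pos hr.1 hz.1, ?_⟩
          calc r * z ≤ max C 1 * (max C 1)⁻¹ :=
                mul_le_mul (hr.2.trans (le_max_left _ _)) hz.2 hz.1.le hD0.le
            _ = 1 := mul_inv_cancel₀ hD0.ne'
        simp only [indicator_of_mem hz, indicator_of_mem hrz]
        rw [← ENNReal.ofReal_mul (by positivity)]
        refine ENNReal.ofReal_le_ofReal ?_
        rw [← Real.mul_rpow hc.le (abs_nonneg z), abs_mul, abs_of_pos hr.1]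
        exact Real.rpow_le_rpow (by positivity)
          (mul_le_mul_of_nonneg_right (le_of_lt hrc) (abs_nonneg z)) hp.le
      have h3 := ENNReal.lt_top_of_mul_ne_top_right hle.ne hmc
      exact ENNReal.lt_top_of_mul_ne_top_right h3.ne
        (ENNReal.ofReal_pos.2 (by positivity)).ne'
    -- The remaining z are bounded away from 0, where ν has finite mass and z^p ≤ 1.
    have hsub : Ioc (0 : ℝ) 1 ⊆ Ioc 0 (max C 1)⁻¹ ∪ Ioc (max C 1)⁻¹ 1 := by
      intro z hz
      rcases le_or_gt z (max C 1)⁻¹ with h1 | h1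
      · exact Or.inl ⟨hz.1, h1⟩
      · exact Or.inr ⟨h1, hz.2⟩
    refine (lintegral_mono_set hsub).trans_lt ((lintegral_union_le _ _ _).trans_lt ?_)
    refine ENNReal.add_lt_top.2 ⟨hsmall, ?_⟩
    refine lt_of_le_of_lt (b := ∫⁻ _ in Ioc (max C 1)⁻¹ 1, 1 ∂ν) ?_ ?_
    · refine setLIntegral_mono' measurableSet_Ioc fun z hz => ?_
      have hz0 : 0 < z := lt_trans (by positivity) hz.1
      rw [ENNReal.ofReal_le_one, abs_of_pos hz0]
      exact Real.rpow_le_one hz0.le hz.2 hp.le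
    · rw [setLIntegral_one]
      exact (measure_mono Ioc_subset_Ioi_self).trans_lt (htail _ (by positivity))
  · intro h
    -- Original jumps z ≤ 1 give the power integral; jumps z > 1 shrunk below 1 contribute at most
    -- their ν-mass.
    refine lt_of_le_of_lt (b := ∫⁻ _, (ENNReal.ofReal (max C 1 ^ p) *
      ∫⁻ z in Ioc 0 1, ENNReal.ofReal (|z| ^ p) ∂ν + ν (Ioi 1)) ∂m) ?_ ?_
    · refine lintegral_mono_ae ?_
      filter_upwards [hm] with r hr
      rw [← lintegral_const_mul _ hmeas, ← lintegral_indicator measurableSet_Ioc,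
        ← lintegral_indicator_one measurableSet_Ioi,
        ← lintegral_add_right _ (measurable_one.indicator measurableSet_Ioi)]
      refine lintegral_mono_ae ?_
      filter_upwards [hν] with z hz
      by_cases hrz : r * z ∈ Ioc (0 : ℝ) 1
      swap
      · simp [indicator_of_notMem hrz]
      rw [indicator_of_mem hrz]
      rcases le_or_gt z 1 with hz1 | hz1
      · rw [indicator_of_mem (show z ∈ Ioc (0 : ℝ) 1 from ⟨hz, hz1⟩)]
        refine le_add_right ?_
        rw [← ENNReal.ofReal_mul (by positivity)]
        refine ENNReal.ofReal_le_ofReal ?_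
        rw [← Real.mul_rpow hD0.le (abs_nonneg z), abs_mul, abs_of_pos hr.1]
        exact Real.rpow_le_rpow (by have := hr.1; positivity)
          (mul_le_mul_of_nonneg_right (hr.2.trans (le_max_left _ _)) (abs_nonneg z)) hp.le
      · rw [indicator_of_mem (show z ∈ Ioi (1 : ℝ) from hz1)]
        refine le_add_left ?_
        simp only [Pi.one_apply]
        rw [ENNReal.ofReal_le_one, abs_of_pos hrz.1]
        exact Real.rpow_le_one hrz.1.le hrz.2 hp.le
    · rw [lintegral_const]
      exact ENNReal.mul_lt_top (ENNReal.add_lt_top.2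
        ⟨ENNReal.mul_lt_top ENNReal.ofReal_lt_top h, htail 1 one_pos⟩) (measure_lt_top _ _)

end Mixture

/-! ### From mixed Laplace exponents to Lévy measures and indices -/

section Main

variable {Ω : Type u} [MeasurableSpace Ω] {P : Measure Ω} {X : ℝ≥0 → Ω → ℝ} {b : ℝ}
  {ν : Measure ℝ} {Ω' : Type v} [MeasurableSpace Ω'] {P' : Measure Ω'} {W : ℝ≥0 → Ω' → ℝ}
  {m : Measure ℝ} [IsFiniteMeasure m] {C : ℝ}

/-- If the Laplace exponent of `W` is a mixture of the rescaled Laplace exponents of `X`, then the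
Lévy measure of `W` is the corresponding mixture of rescaled copies of the one of `X`. -/
theorem HasCharacteristics.mulMixture (h : HasCharacteristics P X b ν)
    (hm : ∀ᵐ r ∂m, 0 < r ∧ r ≤ C)
    (hW : ∀ u : ℝ, 0 ≤ u →
      laplaceTransform P' (W 1) u = Real.exp (∫ r, logLaplace P X (r * u) ∂m)) :
    HasCharacteristics P' W (b * ∫ r, r ∂m) (mulMixture m ν) := by
  have := h.sigmaFinite
  have hnull := mulMixture_Iic hm h.ae_pos
  have hae : ∀ᵐ z ∂(RegulatedClock.mulMixture m ν), 0 < z := by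
    have : ∀ᵐ z ∂(RegulatedClock.mulMixture m ν), z ∉ Iic (0 : ℝ) :=
      measure_eq_zero_iff_ae_notMem.1 hnull
    filter_upwards [this] with z hz
    simpa using hz
  have hrestr := Measure.restrict_eq_self_of_ae_mem
    (show ∀ᵐ z ∂(RegulatedClock.mulMixture m ν), z ∈ Ioi (0 : ℝ) from hae)
  have hmin : ∫⁻ z, ENNReal.ofReal (min z 1) ∂(RegulatedClock.mulMixture m ν) < ⊤ := by
    refine lintegral_min_mulMixture_lt_top hm h.ae_pos ?_
    simpa only [h.restrict_eq] using h.lintegral_lt_top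
  have hintmin : Integrable (fun z : ℝ => min z 1) (RegulatedClock.mulMixture m ν) := by
    refine ⟨by fun_prop, ?_⟩
    rw [hasFiniteIntegral_iff_ofReal (hae.mono fun z hz => le_min hz.le zero_le_one)]
    exact hmin
  refine ⟨mul_nonneg h.drift_nonneg (integral_nonneg_of_ae (hm.mono fun r hr => hr.1.le)), hnull,
    by rwa [hrestr], fun u hu => ?_⟩
  have hi : Integrable (fun z : ℝ => Real.exp (-u * z) - 1) (RegulatedClock.mulMixture m ν) := by
    refine (hintmin.const_mul (max u 1)).mono' (by fun_prop) ?_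
    filter_upwards [hae] with z hz
    exact abs_exp_neg_sub_one_le hu hz.le
  have hip : Integrable (fun p : ℝ × ℝ => Real.exp (-u * (p.1 * p.2)) - 1) (m.prod ν) :=
    (integrable_map_measure (f := fun p : ℝ × ℝ => p.1 * p.2) (by fun_prop)
      (by fun_prop)).1 hi
  have hid : Integrable (fun r : ℝ => r) m := by
    refine (integrable_const C).mono' (by fun_prop) ?_
    filter_upwards [hm] with r hr
    rw [Real.norm_eq_abs, abs_of_pos hr.1]
    exact hr.2
  rw [hW u hu, hrestr, RegulatedClock.mulMixture, integral_map (by fun_prop) (by fun_prop),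
    integral_prod _ hip]
  congr 1
  have hip' : Integrable (fun r => ∫ z, (Real.exp (-u * (r * z)) - 1) ∂ν) m :=
    hip.integral_prod_left
  have : ∫ r, logLaplace P X (r * u) ∂m =
      ∫ r, ((-b * u) * r + ∫ z, (Real.exp (-u * (r * z)) - 1) ∂ν) ∂m := by
    refine integral_congr_ae ?_
    filter_upwards [hm] with r hr
    rw [h.logLaplace_eq (mul_nonneg hr.1.le hu)]
    congr 1
    · ring
    · congr 1
      ext z
      ring_nf
  rw [this, integral_add (hid.const_mul _) hip', integral_const_mul]
  ring

lemma HasCharacteristics.blumenthalGetoorIndex_mulMixture (h : HasCharacteristics P X b ν)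
    (hm : ∀ᵐ r ∂m, 0 < r ∧ r ≤ C) (hm0 : m ≠ 0) {b' : ℝ}
    (hW : HasCharacteristics P' W b' (RegulatedClock.mulMixture m ν)) :
    blumenthalGetoorIndex P' W = blumenthalGetoorIndex P X := by
  have := h.sigmaFinite
  rw [blumenthalGetoorIndex, blumenthalGetoorIndex, h.levyMeasure_eq, hW.levyMeasure_eq]
  congr 1
  ext p
  refine and_congr_right fun hp => ?_
  exact lintegral_rpow_mulMixture_lt_top_iff hm hm0 h.ae_pos
    (fun δ hδ => h.measure_Ioi_lt_top hδ) hp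

/-- Monotonicity supplies measurability of the exponent and, later, convergence of Riemann sums
without any continuity. -/
lemma HasCharacteristics.antitoneOn_logLaplace (h : HasCharacteristics P X b ν) :
    AntitoneOn (logLaplace P X) (Ici 0) := by
  intro u hu w hw huw
  rw [mem_Ici] at hu hw
  rw [h.logLaplace_eq hu, h.logLaplace_eq hw]
  refine add_le_add ?_ ?_
  · have := h.drift_nonneg
    nlinarith
  · refine integral_mono_ae (h.integrable_exp_sub_one hw) (h.integrable_exp_sub_one hu) ?_
    filter_upwards [h.ae_pos] with z hz
    have : Real.exp (-w * z) ≤ Real.exp (-u * z) := Real.exp_le_exp.2 (by nlinarith)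
    simpa using this

lemma HasCharacteristics.logLaplace_zero (h : HasCharacteristics P X b ν) :
    logLaplace P X 0 = 0 := by
  rw [h.logLaplace_eq le_rfl]
  simp

/-- `logLaplace` extended by `0` to the negative half-line is measurable. -/
lemma HasCharacteristics.measurable_logLaplace_max (h : HasCharacteristics P X b ν) :
    Measurable fun u => logLaplace P X (max u 0) := by
  refine Antitone.measurable fun u w huw => ?_
  exact h.antitoneOn_logLaplace (mem_Ici.2 (le_max_right _ _)) (mem_Ici.2 (le_max_right _ _))
    (max_le_max_right _ huw)

/-- Mixtures parametrised by the uniform distribution on the unit interval. -/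
theorem HasCharacteristics.exists_mixture_of_uniform (h : HasCharacteristics P X b ν) {g : ℝ → ℝ}
    (hg : AEMeasurable g (volume.restrict (Ioc 0 1)))
    (hgC : ∀ᵐ s ∂(volume.restrict (Ioc (0 : ℝ) 1)), 0 ≤ g s ∧ g s ≤ C)
    (hg0 : ¬ ∀ᵐ s ∂(volume.restrict (Ioc (0 : ℝ) 1)), g s ≤ 0)
    (hW : ∀ u : ℝ, 0 ≤ u → laplaceTransform P' (W 1) u =
      Real.exp (∫ s in (0 : ℝ)..1, logLaplace P X (g s * u))) :
    (∃ b' ν', HasCharacteristics P' W b' ν') ∧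
      blumenthalGetoorIndex P' W = blumenthalGetoorIndex P X := by
  let m₀ := (volume.restrict (Ioc (0 : ℝ) 1)).map g
  have : IsFiniteMeasure m₀ := by
    refine ⟨?_⟩
    rw [Measure.map_apply_of_aemeasurable hg MeasurableSet.univ]
    exact measure_lt_top _ _
  have hC0 : ∀ᵐ r ∂m₀, 0 ≤ r ∧ r ≤ C := by
    rw [ae_map_iff hg (by measurability)]
    exact hgC
  have hC : ∀ᵐ r ∂(m₀.restrict (Ioi 0)), 0 < r ∧ r ≤ C := by
    filter_upwards [ae_restrict_of_ae hC0, ae_restrict_mem measurableSet_Ioi] with r hr hr0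
    exact ⟨hr0, hr.2⟩
  -- The factor 0 is discarded: it costs nothing because the exponent vanishes at 0, and what
  -- remains is nonzero since g is not a.e. nonpositive.
  have hne : m₀.restrict (Ioi 0) ≠ 0 := by
    intro hz
    rw [Measure.restrict_eq_zero, measure_eq_zero_iff_ae_notMem,
      ae_map_iff hg (by measurability)] at hz
    exact hg0 (hz.mono fun s hs => by simpa using hs)
  have hW' : ∀ u : ℝ, 0 ≤ u → laplaceTransform P' (W 1) u =
      Real.exp (∫ r, logLaplace P X (r * u) ∂(m₀.restrict (Ioi 0))) := by
    intro u hu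
    rw [hW u hu, intervalIntegral.integral_of_le zero_le_one]
    congr 1
    have e1 : ∫ s in Ioc (0 : ℝ) 1, logLaplace P X (g s * u) =
        ∫ s in Ioc (0 : ℝ) 1, logLaplace P X (max (g s * u) 0) := by
      refine integral_congr_ae ?_
      filter_upwards [hgC] with s hs
      rw [max_eq_left (mul_nonneg hs.1 hu)]
    have hmeas : Measurable fun r => logLaplace P X (max (r * u) 0) :=
      h.measurable_logLaplace_max.comp (measurable_id.mul_const u)
    rw [e1, ← integral_map (f := fun r => logLaplace P X (max (r * u) 0)) hg
      hmeas.aestronglyMeasurable]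
    have e2 : ∫ r in Ioi 0, logLaplace P X (r * u) ∂m₀ =
        ∫ r in Ioi 0, logLaplace P X (max (r * u) 0) ∂m₀ := by
      refine setIntegral_congr_fun measurableSet_Ioi fun r hr => ?_
      simp only [max_eq_left (mul_nonneg (le_of_lt hr) hu)]
    rw [e2]
    symm
    refine setIntegral_eq_integral_of_forall_compl_eq_zero fun r hr => ?_
    rw [max_eq_right, h.logLaplace_zero]
    exact mul_nonpos_of_nonpos_of_nonneg (by simpa using hr) hu
  have hchar := h.mulMixture hC hW'
  exact ⟨⟨_, _, hchar⟩, h.blumenthalGetoorIndex_mulMixture hC hne hchar⟩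

end Main

/-! ### Laplace transforms of time integrals of a subordinator -/

/-- Left Riemann sums of a monotone function converge to its integral. -/
lemma tendsto_riemannSum_of_monotone {f : ℝ → ℝ} (hf : Monotone f) :
    Tendsto (fun N : ℕ => (N : ℝ)⁻¹ * ∑ i ∈ Finset.range N, f (i / N)) atTop
      (𝓝 (∫ s in (0 : ℝ)..1, f s)) := by
  have hscale : ∀ N : ℕ, 0 < N →
      (∫ x in (0 : ℝ)..0 + N, f (x / N)) = N * ∫ s in (0 : ℝ)..1, f s := by
    intro N hN
    have hN' : (N : ℝ) ≠ 0 := by positivity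
    rw [intervalIntegral.integral_comp_div _ hN', zero_div, zero_add, div_self hN', smul_eq_mul]
  have hmono : ∀ N : ℕ, Monotone fun x : ℝ => f (x / N) := fun N x y hxy =>
    hf (div_le_div_of_nonneg_right hxy (by positivity))
  have hlow : ∀ N : ℕ, 0 < N →
      (N : ℝ)⁻¹ * ∑ i ∈ Finset.range N, f (i / N) ≤ ∫ s in (0 : ℝ)..1, f s := by
    intro N hN
    have := ((hmono N).monotoneOn (Icc 0 (0 + N))).sum_le_integral
    rw [hscale N hN] at this
    simp only [zero_add] at this
    rw [inv_mul_le_iff₀ (by positivity)]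
    exact this
  have hupp : ∀ N : ℕ, 0 < N → (∫ s in (0 : ℝ)..1, f s) - (N : ℝ)⁻¹ * (f 1 - f 0) ≤
      (N : ℝ)⁻¹ * ∑ i ∈ Finset.range N, f (i / N) := by
    intro N hN
    have hN' : (N : ℝ) ≠ 0 := by positivity
    have := ((hmono N).monotoneOn (Icc 0 (0 + N))).integral_le_sum
    rw [hscale N hN] at this
    simp only [zero_add] at this
    -- Right and left sums differ by the telescoped amount f(1) - f(0), which vanishes after
    -- division by N.
    have hs : ∑ i ∈ Finset.range N, f (((i + 1 : ℕ) : ℝ) / N) =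
        ∑ i ∈ Finset.range N, f (i / N) + (f 1 - f 0) := by
      have h1 := Finset.sum_range_succ' (fun i : ℕ => f ((i : ℝ) / N)) N
      have h2 := Finset.sum_range_succ (fun i : ℕ => f ((i : ℝ) / N)) N
      simp only [div_self hN', Nat.cast_zero, zero_div] at h1 h2
      linarith
    rw [hs] at this
    have h3 : (∫ s in (0 : ℝ)..1, f s) ≤
        (N : ℝ)⁻¹ * (∑ i ∈ Finset.range N, f (i / N) + (f 1 - f 0)) := by
      rw [le_inv_mul_iff₀ (by positivity)]
      exact this
    rw [mul_add] at h3
    linarith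
  refine tendsto_of_tendsto_of_tendsto_of_le_of_le'
    (g := fun N : ℕ => (∫ s in (0 : ℝ)..1, f s) - (N : ℝ)⁻¹ * (f 1 - f 0)) ?_ tendsto_const_nhds
    ?_ ?_
  · simpa using tendsto_const_nhds.sub
      ((tendsto_inv_atTop_nhds_zero_nat (𝕜 := ℝ)).mul_const (f 1 - f 0))
  · filter_upwards [eventually_gt_atTop 0] with N hN using hupp N hN
  · filter_upwards [eventually_gt_atTop 0] with N hN using hlow N hN

section Increments

variable {Ω : Type u} [MeasurableSpace Ω] {P : Measure Ω} {X : ℝ≥0 → Ω → ℝ} {b : ℝ}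
  {ν : Measure ℝ}

lemma laplaceTransform_eq_mgf (Y : Ω → ℝ) (u : ℝ) : laplaceTransform P Y u = mgf Y P (-u) := rfl

lemma laplaceTransform_eq_of_identDistrib {Ω' : Type v} [MeasurableSpace Ω'] {P' : Measure Ω'}
    {Y : Ω → ℝ} {Y' : Ω' → ℝ} (h : IdentDistrib Y Y' P P') (u : ℝ) :
    laplaceTransform P Y u = laplaceTransform P' Y' u :=
  (h.comp (u := fun y => Real.exp (-u * y)) (by fun_prop)).integral_eq

/-- Independence factorises the transform and stationarity identifies each factor. The Laplace
variable is absorbed into the weights, hence the argument 1. -/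
lemma IsLevySubordinator.laplaceTransform_sum_increments (hX : IsLevySubordinator P X) {N : ℕ}
    (c : ℕ → ℝ) :
    laplaceTransform P (fun ω => ∑ i ∈ Finset.range N,
      c i * (X (((i + 1 : ℕ) : ℝ≥0) / N) ω - X ((i : ℝ≥0) / N) ω)) 1 =
      ∏ i ∈ Finset.range N, laplaceTransform P (X (1 / N)) (c i) := by
  have hmono : Monotone fun i : ℕ => (i : ℝ≥0) / N := fun i j hij =>
    div_le_div_of_nonneg_right (Nat.cast_le.2 hij) zero_le
  have hind := (hX.indep.nat hmono).comp (fun i x => c i * x) (fun i => by fun_prop)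
  have hmeas : ∀ i : ℕ, Measurable ((fun x => c i * x) ∘
      fun ω => X (((i + 1 : ℕ) : ℝ≥0) / N) ω - X ((i : ℝ≥0) / N) ω) := fun i => by
    have h1 := hX.measurable (((i + 1 : ℕ) : ℝ≥0) / N)
    have h2 := hX.measurable ((i : ℝ≥0) / N)
    fun_prop
  have hprod := hind.mgf_sum (t := -1) hmeas (Finset.range N)
  rw [laplaceTransform_eq_mgf]
  convert! hprod using 1
  · congr 1
    ext ω
    simp
  · refine Finset.prod_congr rfl fun i _ => ?_
    have hst := hX.stationary ((i : ℝ≥0) / N) (1 / N)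
    rw [← add_div] at hst
    rw [← laplaceTransform_eq_of_identDistrib hst, laplaceTransform]
    simp only [mgf, Function.comp]
    congr 1
    ext ω
    push_cast
    ring_nf

/-- X₁ is a.s. a sum of N i.i.d. increments, so this is the unique nonnegative N-th root. -/
lemma IsLevySubordinator.laplaceTransform_inv_nat (hX : IsLevySubordinator P X)
    (h : HasCharacteristics P X b ν) {N : ℕ} (hN : 0 < N) {u : ℝ} (hu : 0 ≤ u) :
    laplaceTransform P (X (1 / N)) u = Real.exp ((N : ℝ)⁻¹ * logLaplace P X u) := by
  have hN' : (N : ℝ≥0) ≠ 0 := by positivity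
  have h1 := hX.laplaceTransform_sum_increments (N := N) fun _ => u
  rw [Finset.prod_const, Finset.card_range] at h1
  have h2 : laplaceTransform P (fun ω => ∑ i ∈ Finset.range N,
      u * (X (((i + 1 : ℕ) : ℝ≥0) / N) ω - X ((i : ℝ≥0) / N) ω)) 1 =
      laplaceTransform P (X 1) u := by
    refine integral_congr_ae ?_
    filter_upwards [hX.zero] with ω hω
    rw [← Finset.mul_sum, Finset.sum_range_sub (fun i : ℕ => X ((i : ℝ≥0) / N) ω), div_self hN',
      Nat.cast_zero, zero_div, hω]
    ring_nf
  rw [h2, h.laplaceTransform_eq hu] at h1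
  refine (pow_left_inj₀ (integral_nonneg fun ω => (Real.exp_pos _).le) (Real.exp_pos _).le
    hN.ne').1 ?_
  rw [← h1, ← Real.exp_nat_mul, mul_inv_cancel_left₀ (by positivity)]

/-- The step process which samples a path at the next multiple of `1 / N` integrates to a
weighted sum of increments. -/
lemma integral_sample_eq_sum {m : Measure ℝ} [IsFiniteMeasure m]
    (hm : ∀ᵐ r ∂m, 0 < r ∧ r ≤ 1) {x : ℝ≥0 → ℝ} (hx0 : x 0 = 0) {N : ℕ} (hN : 0 < N) :
    ∫ r : ℝ, x ((⌈r * N⌉₊ : ℝ≥0) / N) ∂m = ∑ i ∈ Finset.range N,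
      m.real (Ioi ((i : ℝ) / N)) * (x (((i + 1 : ℕ) : ℝ≥0) / N) - x ((i : ℝ≥0) / N)) := by
  have hN' : (0 : ℝ) < N := by positivity
  have hpt : ∀ᵐ r : ℝ ∂m, x ((⌈r * N⌉₊ : ℝ≥0) / N) = ∑ i ∈ Finset.range N,
      (Ioi ((i : ℝ) / N)).indicator
        (fun _ => x (((i + 1 : ℕ) : ℝ≥0) / N) - x ((i : ℝ≥0) / N)) r := by
    filter_upwards [hm] with r hr
    have hle : ⌈r * N⌉₊ ≤ N := Nat.ceil_le.2 (by nlinarith [hr.2])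
    have htel := Finset.sum_range_sub (fun i : ℕ => x ((i : ℝ≥0) / N)) ⌈r * N⌉₊
    rw [Nat.cast_zero, zero_div, hx0, sub_zero] at htel
    rw [← htel]
    -- The increment after i/N is included exactly when i/N < r, that is, i < ⌈rN⌉, so the sum
    -- telescopes to the sampled value.
    have hind : ∀ i : ℕ, (Ioi ((i : ℝ) / N)).indicator
        (fun _ => x (((i + 1 : ℕ) : ℝ≥0) / N) - x ((i : ℝ≥0) / N)) r =
        if i < ⌈r * N⌉₊ then x (((i + 1 : ℕ) : ℝ≥0) / N) - x ((i : ℝ≥0) / N) else 0 := by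
      intro i
      rw [indicator_apply]
      refine if_congr ?_ rfl rfl
      rw [mem_Ioi, Nat.lt_ceil, div_lt_iff₀ hN']
    rw [Finset.sum_congr rfl fun i _ => hind i, ← Finset.sum_filter]
    refine Finset.sum_congr ?_ fun _ _ => rfl
    ext i
    simp only [Finset.mem_range, Finset.mem_filter]
    omega
  rw [integral_congr_ae hpt, integral_finsetSum]
  · refine Finset.sum_congr rfl fun i _ => ?_
    rw [integral_indicator measurableSet_Ioi, setIntegral_const, smul_eq_mul]
  · exact fun i _ => (integrable_const _).indicator measurableSet_Ioi

/-- Sampling uses the ceiling so that times approach r from the right, the only side on which paths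
are assumed continuous. -/
lemma tendsto_ceil_mul_div {r : ℝ} (hr : 0 ≤ r) :
    Tendsto (fun N : ℕ => (⌈r * N⌉₊ : ℝ≥0) / N) atTop (𝓝[≥] r.toNNReal) := by
  refine tendsto_nhdsWithin_iff.2 ⟨?_, ?_⟩
  · rw [← NNReal.tendsto_coe, Real.coe_toNNReal _ hr]
    have := (tendsto_nat_ceil_mul_div_atTop hr).comp (tendsto_natCast_atTop_atTop (R := ℝ))
    simpa [Function.comp_def] using this
  · filter_upwards [eventually_gt_atTop 0] with N hN
    rw [mem_Ici, ← NNReal.coe_le_coe, Real.coe_toNNReal _ hr]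
    push_cast
    rw [le_div_iff₀ (by positivity)]
    exact Nat.le_ceil _

lemma tendsto_integral_sample {m : Measure ℝ} [IsFiniteMeasure m]
    (hm : ∀ᵐ r ∂m, 0 < r ∧ r ≤ 1) {x : ℝ≥0 → ℝ} (hx : Monotone x) (hx0 : x 0 = 0)
    (hxc : ∀ t, ContinuousWithinAt x (Ici t) t) :
    Tendsto (fun N : ℕ => ∫ r : ℝ, x ((⌈r * N⌉₊ : ℝ≥0) / N) ∂m) atTop
      (𝓝 (∫ r, x r.toNNReal ∂m)) := by
  refine tendsto_integral_filter_of_dominated_convergence (fun _ => x 1) ?_ ?_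
    (integrable_const _) ?_
  · refine .of_forall fun N => Measurable.aestronglyMeasurable ?_
    have : Measurable fun r : ℝ => (⌈r * N⌉₊ : ℝ≥0) / (N : ℝ≥0) := by fun_prop
    exact hx.measurable.comp this
  · filter_upwards [eventually_gt_atTop 0] with N hN
    filter_upwards [hm] with r hr
    have h0 : 0 ≤ x ((⌈r * N⌉₊ : ℝ≥0) / N) := hx0 ▸ hx zero_le
    rw [Real.norm_eq_abs, abs_of_nonneg h0]
    refine hx ?_
    have hN' : (0 : ℝ) < N := by positivity
    rw [div_le_one (by positivity), Nat.cast_le]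
    exact Nat.ceil_le.2 (by nlinarith [hr.2])
  · filter_upwards [hm] with r hr
    exact (hxc _).tendsto.comp (tendsto_ceil_mul_div hr.1.le)

/-- The Laplace transform of a weighted time integral of a subordinator. -/
theorem IsLevySubordinator.laplaceTransform_integral (hX : IsLevySubordinator P X)
    (h : HasCharacteristics P X b ν) {m : Measure ℝ} [IsFiniteMeasure m]
    (hm : ∀ᵐ r ∂m, 0 < r ∧ r ≤ 1) {u : ℝ} (hu : 0 ≤ u) :
    laplaceTransform P (fun ω => ∫ r, X r.toNNReal ω ∂m) u =
      Real.exp (∫ s in (0 : ℝ)..1, logLaplace P X (m.real (Ioi s) * u)) := by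
  have := hX.isProbabilityMeasure
  let S : ℕ → Ω → ℝ := fun N ω => ∑ i ∈ Finset.range N, m.real (Ioi ((i : ℝ) / N)) *
      (X (((i + 1 : ℕ) : ℝ≥0) / N) ω - X ((i : ℝ≥0) / N) ω)
  have hSmeas : ∀ N, Measurable (S N) := fun N =>
    Finset.measurable_fun_sum _ fun i _ =>
      ((hX.measurable _).sub (hX.measurable _)).const_mul _
  have hlim1 : Tendsto (fun N => laplaceTransform P (S N) u) atTop
      (𝓝 (laplaceTransform P (fun ω => ∫ r, X r.toNNReal ω ∂m) u)) := by
    refine tendsto_integral_of_dominated_convergence (fun _ => 1) ?_ (integrable_const _) ?_ ?_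
    · intro N
      have := hSmeas N
      exact Measurable.aestronglyMeasurable (by fun_prop)
    · intro N
      filter_upwards [hX.monotone] with ω hmono
      rw [Real.norm_eq_abs, abs_of_pos (Real.exp_pos _), Real.exp_le_one_iff]
      refine mul_nonpos_of_nonpos_of_nonneg (by linarith) (Finset.sum_nonneg fun i _ => ?_)
      refine mul_nonneg measureReal_nonneg (sub_nonneg.2 (hmono ?_))
      exact div_le_div_of_nonneg_right (Nat.cast_le.2 (Nat.le_succ i)) zero_le
    · filter_upwards [hX.monotone, hX.rightCts, hX.zero] with ω hmono hcts h0
      have hl := tendsto_integral_sample hm hmono h0 hcts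
      have hl' : Tendsto (fun N => S N ω) atTop (𝓝 (∫ r, X r.toNNReal ω ∂m)) := by
        refine hl.congr' ?_
        filter_upwards [eventually_gt_atTop 0] with N hN
        exact integral_sample_eq_sum hm (x := fun t => X t ω) h0 hN
      exact (Real.continuous_exp.tendsto _).comp (hl'.const_mul _)
  have hmono : Monotone fun s => logLaplace P X (m.real (Ioi s) * u) := by
    intro s t hst
    refine h.antitoneOn_logLaplace (mem_Ici.2 (mul_nonneg measureReal_nonneg hu))
      (mem_Ici.2 (mul_nonneg measureReal_nonneg hu)) ?_
    exact mul_le_mul_of_nonneg_right (measureReal_mono (Ioi_subset_Ioi hst)) hu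
  have hlim2 : Tendsto (fun N => laplaceTransform P (S N) u) atTop
      (𝓝 (Real.exp (∫ s in (0 : ℝ)..1, logLaplace P X (m.real (Ioi s) * u)))) := by
    refine ((Real.continuous_exp.tendsto _).comp
      (tendsto_riemannSum_of_monotone hmono)).congr' ?_
    filter_upwards [eventually_gt_atTop 0] with N hN
    have h1 := hX.laplaceTransform_sum_increments (N := N)
      fun i => m.real (Ioi ((i : ℝ) / N)) * u
    rw [Finset.prod_congr rfl fun i _ => hX.laplaceTransform_inv_nat h hN
      (mul_nonneg measureReal_nonneg hu), ← Real.exp_sum, ← Finset.mul_sum] at h1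
    rw [Function.comp_apply, ← h1]
    simp only [laplaceTransform, S, Finset.mul_sum]
    congr 1
    ext ω
    congr 1
    refine Finset.sum_congr rfl fun i _ => ?_
    ring
  exact tendsto_nhds_unique hlim1 hlim2

end Increments

/-- If `W₁` has the law of `∫ X_r m(dr)`, then `W` has the Blumenthal-Getoor index of `X`. -/
theorem HasCharacteristics.exists_of_integral {Ω : Type u} [MeasurableSpace Ω] {P : Measure Ω}
    {X : ℝ≥0 → Ω → ℝ} {b : ℝ} {ν : Measure ℝ} {Ω' : Type v} [MeasurableSpace Ω']
    {P' : Measure Ω'} {W : ℝ≥0 → Ω' → ℝ}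
    (h : HasCharacteristics P X b ν) (hX : IsLevySubordinator P X)
    {m : Measure ℝ} [IsFiniteMeasure m] (hm : ∀ᵐ r ∂m, 0 < r ∧ r ≤ 1) (hm0 : m ≠ 0)
    (hW : ∀ u : ℝ, 0 ≤ u → laplaceTransform P' (W 1) u =
      laplaceTransform P (fun ω => ∫ r, X r.toNNReal ω ∂m) u) :
    (∃ b' ν', HasCharacteristics P' W b' ν') ∧
      blumenthalGetoorIndex P' W = blumenthalGetoorIndex P X := by
  have hanti : Antitone fun s => m.real (Ioi s) := fun s t hst =>
    measureReal_mono (Ioi_subset_Ioi hst)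
  refine h.exists_mixture_of_uniform (g := fun s => m.real (Ioi s)) (C := m.real univ)
    hanti.measurable.aemeasurable
    (.of_forall fun s => ⟨measureReal_nonneg, measureReal_mono (subset_univ _)⟩) ?_
    fun u hu => (hW u hu).trans (hX.laplaceTransform_integral h hm hu)
  -- Choose δ > 0 with m(δ, ∞) > 0: the tail m(s, ∞) is then positive for all s in (0, min(δ, 1)], a
  -- set of positive length.
  intro hcon
  obtain ⟨δ, hδ, hmδ⟩ := exists_measure_Ioi_ne_zero (hm.mono fun r hr => hr.1) hm0
  have hcon' : ∀ᵐ s ∂(volume : Measure ℝ), s ∈ Ioc (0 : ℝ) 1 → m.real (Ioi s) ≤ 0 :=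
    (ae_restrict_iff' measurableSet_Ioc).1 hcon
  have hpos : volume (Ioc 0 (min δ 1)) ≠ 0 := by
    rw [Real.volume_Ioc]
    simp [hδ]
  refine hpos (measure_mono_null (fun s hs => ?_) (ae_iff.1 hcon'))
  simp only [mem_ofPred_eq, Classical.not_imp, not_le]
  refine ⟨⟨hs.1, hs.2.trans (min_le_right _ _)⟩, measureReal_nonneg.lt_of_ne' fun hs0 => hmδ ?_⟩
  exact measure_mono_null (Ioi_subset_Ioi (hs.2.trans (min_le_left _ _)))
    ((measureReal_eq_zero_iff (measure_ne_top _ _)).1 hs0)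

/-! ### Iterated averages as integrals along a single path -/

/-- The measure `v ^ j dv` on the unit interval. -/
noncomputable def powMeasure (j : ℕ) : Measure ℝ :=
  (volume.restrict (Ioc (0 : ℝ) 1)).withDensity fun v => ENNReal.ofReal (v ^ j)

lemma ae_powMeasure (j : ℕ) : ∀ᵐ v ∂(powMeasure j), 0 < v ∧ v ≤ 1 :=
  (withDensity_absolutelyContinuous _ _).ae_le (ae_restrict_mem measurableSet_Ioc)

instance isFiniteMeasure_powMeasure (j : ℕ) : IsFiniteMeasure (powMeasure j) :=
  isFiniteMeasure_withDensity_ofReal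
    ((intervalIntegrable_iff_integrableOn_Ioc_of_le zero_le_one).1
      ((continuous_pow j).intervalIntegrable 0 1)).2

lemma powMeasure_ne_zero (j : ℕ) : powMeasure j ≠ 0 := by
  rw [powMeasure, Ne, withDensity_eq_zero_iff (by fun_prop)]
  intro h
  have h1 : ∀ᵐ v ∂(volume.restrict (Ioc (0 : ℝ) 1)), False := by
    filter_upwards [h, ae_restrict_mem measurableSet_Ioc] with v hv hv'
    exact (ENNReal.ofReal_pos.2 (pow_pos hv'.1 j)).ne' hv
  have h2 := ae_iff.1 h1
  simp at h2

lemma integral_powMeasure (j : ℕ) (f : ℝ → ℝ) :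
    ∫ v, f v ∂(powMeasure j) = ∫ v in (0 : ℝ)..1, v ^ j * f v := by
  rw [powMeasure, integral_withDensity_eq_integral_toReal_smul (by fun_prop)
    (.of_forall fun _ => ENNReal.ofReal_lt_top), intervalIntegral.integral_of_le zero_le_one]
  refine setIntegral_congr_fun measurableSet_Ioc fun v hv => ?_
  simp only [ENNReal.toReal_ofReal (pow_nonneg hv.1.le j), smul_eq_mul]

section MulMixture

variable {m ρ : Measure ℝ}

instance isFiniteMeasure_mulMixture [IsFiniteMeasure m] [IsFiniteMeasure ρ] :
    IsFiniteMeasure (mulMixture ρ m) := by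
  unfold mulMixture
  infer_instance

lemma ae_mulMixture (hρ : ∀ᵐ v ∂ρ, 0 < v ∧ v ≤ 1) (hm : ∀ᵐ r ∂m, 0 < r ∧ r ≤ 1) :
    ∀ᵐ r ∂(mulMixture ρ m), 0 < r ∧ r ≤ 1 := by
  rw [mulMixture, ae_map_iff (by fun_prop) (by measurability)]
  filter_upwards [Measure.quasiMeasurePreserving_fst.ae hρ,
    Measure.quasiMeasurePreserving_snd.ae hm] with p h1 h2
  exact ⟨mul_pos h1.1 h2.1, mul_le_one₀ h1.2 h2.1.le h2.2⟩

lemma mulMixture_ne_zero [SFinite m] (hρ : ρ ≠ 0) (hm : m ≠ 0) : mulMixture ρ m ≠ 0 := by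
  rw [mulMixture, Ne, Measure.map_eq_zero_iff (by fun_prop), ← Measure.measure_univ_eq_zero,
    ← univ_prod_univ, Measure.prod_prod, mul_eq_zero, Measure.measure_univ_eq_zero,
    Measure.measure_univ_eq_zero]
  tauto

end MulMixture

/-- Integrating `s ^ j ∫ x(s r) m(dr)` over `[0, t]` gives a functional of the same form. -/
lemma integral_pow_mul_integral {m : Measure ℝ} [IsFiniteMeasure m]
    (hm : ∀ᵐ r ∂m, 0 < r ∧ r ≤ 1) {x : ℝ≥0 → ℝ} (hx : Monotone x) (hx0 : x 0 = 0) (j : ℕ)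
    (t : ℝ≥0) :
    ∫ s in (0 : ℝ)..t, s ^ j * ∫ r, x (s.toNNReal * r.toNNReal) ∂m =
      (t : ℝ) ^ (j + 1) * ∫ r, x (t * r.toNNReal) ∂(mulMixture (powMeasure j) m) := by
  have hint : Integrable (fun p : ℝ × ℝ => x (t * (p.1 * p.2).toNNReal))
      ((powMeasure j).prod m) := by
    refine (integrable_const (x t)).mono' ?_ ?_
    · have : Measurable fun p : ℝ × ℝ => t * (p.1 * p.2).toNNReal := by fun_prop
      exact (hx.measurable.comp this).aestronglyMeasurable
    · filter_upwards [Measure.quasiMeasurePreserving_fst.ae (ae_powMeasure j),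
        Measure.quasiMeasurePreserving_snd.ae hm] with p h1 h2
      have h0 : 0 ≤ x (t * (p.1 * p.2).toNNReal) := hx0 ▸ hx zero_le
      rw [Real.norm_eq_abs, abs_of_nonneg h0]
      refine hx (mul_le_of_le_one_right zero_le ?_)
      rw [Real.toNNReal_le_one]
      exact mul_le_one₀ h1.2 h2.1.le h2.2
  have hmeas : Measurable fun r : ℝ => x (t * r.toNNReal) := by
    have : Measurable fun r : ℝ => t * r.toNNReal := by fun_prop
    exact hx.measurable.comp this
  rw [mulMixture, integral_map (by fun_prop) hmeas.aestronglyMeasurable, integral_prod _ hint,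
    integral_powMeasure]
  -- Substituting s = t v extracts t^(j+1) and leaves an average over products v r, with v weighted
  -- by v^j.
  have hsub := intervalIntegral.smul_integral_comp_mul_left (a := 0) (b := 1)
    (fun s : ℝ => s ^ j * ∫ r, x (s.toNNReal * r.toNNReal) ∂m) (t : ℝ)
  rw [mul_zero, mul_one] at hsub
  rw [← hsub, smul_eq_mul, pow_succ', mul_assoc]
  congr 1
  rw [← intervalIntegral.integral_const_mul]
  refine intervalIntegral.integral_congr fun v hv => ?_
  rw [uIcc_of_le zero_le_one] at hv
  simp only [mul_pow, mul_assoc]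
  congr 2
  refine integral_congr_ae (.of_forall fun r => ?_)
  simp only
  rw [Real.toNNReal_mul t.coe_nonneg, Real.toNNReal_coe, Real.toNNReal_mul hv.1, mul_assoc]

section Paths

variable {Ω : Type u}

/-- Iterated running averages are averages against a fixed measure on `(0, 1]`. -/
theorem exists_repeatedAverage_eq (X : ℝ≥0 → Ω → ℝ) (k : ℕ) :
    ∃ m : Measure ℝ, IsFiniteMeasure m ∧ (∀ᵐ r ∂m, 0 < r ∧ r ≤ 1) ∧ m ≠ 0 ∧
      ∀ ω, (Monotone fun t => X t ω) → X 0 ω = 0 →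
        ∀ t, repeatedAverage X k t ω = ∫ r, X (t * r.toNNReal) ω ∂m := by
  induction k with
  | zero =>
    refine ⟨Measure.dirac 1, inferInstance, ?_, NeZero.ne _, fun ω hω _ t => ?_⟩
    · rw [ae_dirac_iff (by measurability)]
      norm_num
    · simp [repeatedAverage]
  | succ k ih =>
    obtain ⟨m, _, hm, hm0, hA⟩ := ih
    refine ⟨mulMixture (powMeasure 0) m, inferInstance, ae_mulMixture (ae_powMeasure 0) hm,
      mulMixture_ne_zero (powMeasure_ne_zero 0) hm0, fun ω hω hω0 t => ?_⟩
    rw [repeatedAverage, runningAverage]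
    have h1 := integral_pow_mul_integral hm hω hω0 0 t
    simp only [pow_zero, one_mul, zero_add, pow_one] at h1
    simp only [hA ω hω hω0, h1]
    -- At t = 0 both sides are 0, by the convention 0⁻¹ = 0 and because the path starts at 0.
    rcases eq_or_ne t 0 with rfl | ht
    · simp [hω0]
    · rw [inv_mul_cancel_left₀ (by simpa using ht)]

/-- Iterated integrals are rescaled averages against a fixed measure on `(0, 1]`. -/
theorem exists_iteratedIntegral_eq (X : ℝ≥0 → Ω → ℝ) (k : ℕ) :
    ∃ m : Measure ℝ, IsFiniteMeasure m ∧ (∀ᵐ r ∂m, 0 < r ∧ r ≤ 1) ∧ m ≠ 0 ∧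
      ∀ ω, (Monotone fun t => X t ω) → X 0 ω = 0 →
        ∀ t : ℝ≥0, iteratedIntegral X k t ω = (t : ℝ) ^ k * ∫ r, X (t * r.toNNReal) ω ∂m := by
  induction k with
  | zero =>
    refine ⟨Measure.dirac 1, inferInstance, ?_, NeZero.ne _, fun ω hω _ t => ?_⟩
    · rw [ae_dirac_iff (by measurability)]
      norm_num
    · simp [iteratedIntegral]
  | succ k ih =>
    obtain ⟨m, _, hm, hm0, hA⟩ := ih
    refine ⟨mulMixture (powMeasure k) m, inferInstance, ae_mulMixture (ae_powMeasure k) hm,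
      mulMixture_ne_zero (powMeasure_ne_zero k) hm0, fun ω hω hω0 t => ?_⟩
    rw [iteratedIntegral, ← integral_pow_mul_integral hm hω hω0 k t]
    refine intervalIntegral.integral_congr fun s hs => ?_
    rw [uIcc_of_le t.coe_nonneg] at hs
    simp only [hA ω hω hω0, Real.coe_toNNReal _ hs.1]

end Paths

/-! ### Incomplete gamma function and logarithmic weights -/

section UpperGamma

variable {n : ℝ}

lemma integrableOn_gammaIntegrand (hn : 0 < n) :
    IntegrableOn (fun r : ℝ => r ^ (n - 1) * Real.exp (-r)) (Ioi 0) := by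
  simpa only [mul_comm] using Real.GammaIntegral_convergent hn

lemma gammaIntegrand_pos {r : ℝ} (hr : 0 < r) : 0 < r ^ (n - 1) * Real.exp (-r) :=
  mul_pos (Real.rpow_pos_of_pos hr _) (Real.exp_pos _)

lemma upperGamma_zero (hn : 0 < n) : upperGamma n 0 = Real.Gamma n := by
  rw [Real.Gamma_eq_integral hn, upperGamma]
  simp only [mul_comm]

lemma upperGamma_nonneg {x : ℝ} (hx : 0 ≤ x) : 0 ≤ upperGamma n x :=
  setIntegral_nonneg measurableSet_Ioi fun _ hr => (gammaIntegrand_pos (hx.trans_lt hr)).le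

lemma antitoneOn_upperGamma (hn : 0 < n) : AntitoneOn (upperGamma n) (Ici 0) := by
  intro x hx y _ hxy
  refine setIntegral_mono_set
    ((integrableOn_gammaIntegrand hn).mono_set (Ioi_subset_Ioi hx)) ?_
    (Ioi_subset_Ioi hxy).eventuallyLE
  filter_upwards [ae_restrict_mem measurableSet_Ioi] with r hr
  exact (gammaIntegrand_pos (lt_of_le_of_lt (mem_Ici.1 hx) hr)).le

lemma upperGamma_lt_Gamma (hn : 0 < n) {x : ℝ} (hx : 0 < x) :
    upperGamma n x < Real.Gamma n := by
  have hi := integrableOn_gammaIntegrand hn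
  have hsplit := setIntegral_union (Set.Ioc_disjoint_Ioi (a := (0 : ℝ)) (le_refl x))
    measurableSet_Ioi (hi.mono_set Ioc_subset_Ioi_self) (hi.mono_set (Ioi_subset_Ioi hx.le))
  rw [Ioc_union_Ioi_eq_Ioi hx.le] at hsplit
  have hpos : 0 < ∫ r in Ioc 0 x, r ^ (n - 1) * Real.exp (-r) := by
    rw [← intervalIntegral.integral_of_le hx.le]
    refine intervalIntegral.intervalIntegral_pos_of_pos_on ?_
      (fun r hr => gammaIntegrand_pos hr.1) hx
    exact (intervalIntegrable_iff_integrableOn_Ioc_of_le hx.le).2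
      (hi.mono_set Ioc_subset_Ioi_self)
  rw [← upperGamma_zero hn]
  unfold upperGamma
  linarith

/-- The weights `(-log v) ^ (n - 1)` are integrable on the unit interval. -/
lemma integrableOn_neg_log_rpow (hn : 0 < n) :
    IntegrableOn (fun v : ℝ => (-Real.log v) ^ (n - 1)) (Ioo 0 1) := by
  have himg : (fun r : ℝ => Real.exp (-r)) '' Ioi 0 = Ioo 0 1 := by
    ext v
    constructor
    · rintro ⟨r, hr, rfl⟩
      exact ⟨Real.exp_pos _, Real.exp_lt_one_iff.2 (neg_lt_zero.2 hr)⟩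
    · intro hv
      refine ⟨-Real.log v, neg_pos.2 (Real.log_neg hv.1 hv.2), ?_⟩
      simp only [neg_neg, Real.exp_log hv.1]
  -- The substitution v = exp(-r) turns the weight into the gamma integrand.
  rw [← himg, integrableOn_image_iff_integrableOn_abs_deriv_smul measurableSet_Ioi
    (f' := fun r => -Real.exp (-r))
    (fun r _ => by simpa using ((hasDerivAt_neg r).exp).hasDerivWithinAt)
    (fun r _ s _ hrs => neg_injective (Real.exp_injective hrs))]
  refine (integrableOn_gammaIntegrand hn).congr_fun (fun r _ => ?_) measurableSet_Ioi
  simp only [abs_neg, abs_of_pos (Real.exp_pos _), Real.log_exp, neg_neg, smul_eq_mul, mul_comm]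

end UpperGamma

/-! ### The three types of clock -/

section Clocks

variable {Ω : Type u} [MeasurableSpace Ω] {P : Measure Ω} {X : ℝ≥0 → Ω → ℝ} {b : ℝ}
  {ν : Measure ℝ} {Ω' : Type v} [MeasurableSpace Ω'] {P' : Measure Ω'} {W : ℝ≥0 → Ω' → ℝ} {n : ℝ}

lemma not_ae_nonpos_of_pos_Ioo {g : ℝ → ℝ} (hg : ∀ s ∈ Ioo (0 : ℝ) 1, 0 < g s) :
    ¬ ∀ᵐ s ∂(volume.restrict (Ioc (0 : ℝ) 1)), g s ≤ 0 := by
  intro h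
  have h' := ae_iff.1 ((ae_restrict_iff' measurableSet_Ioc).1 h)
  have hle : Ioo (0 : ℝ) 1 ⊆ {s | ¬ (s ∈ Ioc (0 : ℝ) 1 → g s ≤ 0)} := fun s hs hcon =>
    (hg s hs).not_ge (hcon ⟨hs.1, hs.2.le⟩)
  simpa using measure_mono_null hle h'

lemma HasCharacteristics.exists_of_typeI_laplace (h : HasCharacteristics P X b ν) (hn : 0 < n)
    (hW : ∀ u : ℝ, 0 ≤ u → laplaceTransform P' (W 1) u = Real.exp (∫ s in (0 : ℝ)..1,
        logLaplace P X ((1 - upperGamma n (-Real.log s) / Real.Gamma n) * u))) :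
    (∃ b' ν', HasCharacteristics P' W b' ν') ∧
      blumenthalGetoorIndex P' W = blumenthalGetoorIndex P X := by
  have hΓ := Real.Gamma_pos_of_pos hn
  have hlog : ∀ s ∈ Ioc (0 : ℝ) 1, 0 ≤ -Real.log s := fun s hs =>
    neg_nonneg.2 (Real.log_nonpos hs.1.le hs.2)
  refine h.exists_mixture_of_uniform
    (g := fun s => 1 - upperGamma n (-Real.log s) / Real.Gamma n) (C := 1) ?_ ?_ ?_ hW
  -- Truncation at 0 gives a globally monotone, hence measurable, version; it agrees with g on (0,
  -- 1], where -log s ≥ 0.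
  · have hanti : Antitone fun x => upperGamma n (max x 0) := fun x y hxy =>
      antitoneOn_upperGamma hn (mem_Ici.2 (le_max_right _ _)) (mem_Ici.2 (le_max_right _ _))
        (max_le_max_right _ hxy)
    have hmeas : Measurable fun s => 1 - upperGamma n (max (-Real.log s) 0) / Real.Gamma n :=
      ((hanti.measurable.comp (Real.measurable_log.neg)).div_const _).const_sub _
    refine ⟨_, hmeas, ?_⟩
    filter_upwards [ae_restrict_mem measurableSet_Ioc] with s hs
    rw [max_eq_left (hlog s hs)]
  · filter_upwards [ae_restrict_mem measurableSet_Ioc] with s hs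
    have h1 := upperGamma_nonneg (n := n) (hlog s hs)
    have h2 := antitoneOn_upperGamma hn self_mem_Ici (mem_Ici.2 (hlog s hs)) (hlog s hs)
    rw [upperGamma_zero hn] at h2
    have h3 := (div_le_one hΓ).2 h2
    have h4 := div_nonneg h1 hΓ.le
    exact ⟨by linarith, by linarith⟩
  · refine not_ae_nonpos_of_pos_Ioo fun s hs => ?_
    have := (div_lt_one hΓ).2
      (upperGamma_lt_Gamma hn (neg_pos.2 (Real.log_neg hs.1 hs.2)))
    linarith

lemma HasCharacteristics.exists_of_typeII_laplace (h : HasCharacteristics P X b ν) (hn : 0 < n)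
    (hW : ∀ u : ℝ, 0 ≤ u → laplaceTransform P' (W 1) u = Real.exp (1 / Real.Gamma n *
      ∫ s in (0 : ℝ)..1, (-Real.log s) ^ (n - 1) * logLaplace P X (u * s))) :
    (∃ b' ν', HasCharacteristics P' W b' ν') ∧
      blumenthalGetoorIndex P' W = blumenthalGetoorIndex P X := by
  have hΓ := Real.Gamma_pos_of_pos hn
  let d : ℝ → ℝ := fun s => (-Real.log s) ^ (n - 1) / Real.Gamma n
  have hd : ∀ s ∈ Ioo (0 : ℝ) 1, 0 < d s := fun s hs =>
    div_pos (Real.rpow_pos_of_pos (neg_pos.2 (Real.log_neg hs.1 hs.2)) _) hΓ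
  have hdm : Measurable fun s => ENNReal.ofReal (d s) := by fun_prop
  -- The open interval keeps the density positive: at s = 1 the weight is a power of 0.
  let m : Measure ℝ := (volume.restrict (Ioo (0 : ℝ) 1)).withDensity fun s => ENNReal.ofReal (d s)
  have : IsFiniteMeasure m :=
    isFiniteMeasure_withDensity_ofReal ((integrableOn_neg_log_rpow hn).div_const _).2
  have hm : ∀ᵐ r ∂m, 0 < r ∧ r ≤ 1 := by
    refine (withDensity_absolutelyContinuous _ _).ae_le ?_
    filter_upwards [ae_restrict_mem measurableSet_Ioo] with s hs
    exact ⟨hs.1, hs.2.le⟩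
  have hm0 : m ≠ 0 := by
    rw [Ne, withDensity_eq_zero_iff hdm.aemeasurable]
    intro hz
    have h1 : ∀ᵐ v ∂(volume.restrict (Ioo (0 : ℝ) 1)), False := by
      filter_upwards [hz, ae_restrict_mem measurableSet_Ioo] with v hv hv'
      exact (ENNReal.ofReal_pos.2 (hd v hv')).ne' hv
    simpa using ae_iff.1 h1
  have hW' : ∀ u : ℝ, 0 ≤ u → laplaceTransform P' (W 1) u =
      Real.exp (∫ r, logLaplace P X (r * u) ∂m) := by
    intro u hu
    rw [hW u hu, integral_withDensity_eq_integral_toReal_smul hdm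
      (.of_forall fun _ => ENNReal.ofReal_lt_top), intervalIntegral.integral_of_le zero_le_one,
      integral_Ioc_eq_integral_Ioo, ← integral_const_mul]
    congr 1
    refine setIntegral_congr_fun measurableSet_Ioo fun s hs => ?_
    simp only [ENNReal.toReal_ofReal (hd s hs).le, smul_eq_mul, d, mul_comm u s]
    ring
  have hchar := h.mulMixture hm hW'
  exact ⟨⟨_, _, hchar⟩, h.blumenthalGetoorIndex_mulMixture hm hm0 hchar⟩

lemma HasCharacteristics.exists_of_typeIII_laplace (h : HasCharacteristics P X b ν) (hn : 0 < n)
    (hW : ∀ u : ℝ, 0 ≤ u → laplaceTransform P' (W 1) u = Real.exp (∫ s in (0 : ℝ)..1,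
        logLaplace P X (s ^ n * u / Real.Gamma (n + 1)))) :
    (∃ b' ν', HasCharacteristics P' W b' ν') ∧
      blumenthalGetoorIndex P' W = blumenthalGetoorIndex P X := by
  have hΓ := Real.Gamma_pos_of_pos (by linarith : 0 < n + 1)
  refine h.exists_mixture_of_uniform (g := fun s => s ^ n / Real.Gamma (n + 1))
    (C := 1 / Real.Gamma (n + 1)) (by fun_prop) ?_ ?_ ?_
  · filter_upwards [ae_restrict_mem measurableSet_Ioc] with s hs
    exact ⟨div_nonneg (Real.rpow_nonneg hs.1.le _) hΓ.le,
      div_le_div_of_nonneg_right (Real.rpow_le_one hs.1.le hs.2 hn.le) hΓ.le⟩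
  · exact not_ae_nonpos_of_pos_Ioo fun s hs => div_pos (Real.rpow_pos_of_pos hs.1 _) hΓ
  · intro u hu
    simpa only [mul_div_right_comm] using hW u hu

/-- Subordinators induced by a process whose value at time `1` is a weighted time integral. -/
lemma HasCharacteristics.exists_of_isInducedBy (h : HasCharacteristics P X b ν)
    (hX : IsLevySubordinator P X) {A : ℝ≥0 → Ω → ℝ} (hW : IsInducedBy P A P' W)
    {m : Measure ℝ} [IsFiniteMeasure m] (hm : ∀ᵐ r ∂m, 0 < r ∧ r ≤ 1) (hm0 : m ≠ 0)
    (hA : ∀ ω, (Monotone fun t => X t ω) → X 0 ω = 0 → A 1 ω = ∫ r, X r.toNNReal ω ∂m) :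
    (∃ b' ν', HasCharacteristics P' W b' ν') ∧
      blumenthalGetoorIndex P' W = blumenthalGetoorIndex P X := by
  refine h.exists_of_integral hX hm hm0 fun u _ => ?_
  rw [laplaceTransform_eq_of_identDistrib (hW.identDistrib 1)]
  refine integral_congr_ae ?_
  filter_upwards [hX.monotone, hX.zero] with ω h1 h2
  simp only [hA ω h1 h2]

lemma HasCharacteristics.exists_of_repeatedAverage (h : HasCharacteristics P X b ν)
    (hX : IsLevySubordinator P X) {k : ℕ} (hW : IsInducedBy P (repeatedAverage X k) P' W) :
    (∃ b' ν', HasCharacteristics P' W b' ν') ∧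
      blumenthalGetoorIndex P' W = blumenthalGetoorIndex P X := by
  obtain ⟨m, _, hm, hm0, hA⟩ := exists_repeatedAverage_eq X k
  exact h.exists_of_isInducedBy hX hW hm hm0 fun ω h1 h2 => by
    simpa only [one_mul] using hA ω h1 h2 1

lemma HasCharacteristics.exists_of_quasiAverage (h : HasCharacteristics P X b ν)
    (hX : IsLevySubordinator P X) {k : ℕ} (hW : IsInducedBy P (quasiAverage X k) P' W) :
    (∃ b' ν', HasCharacteristics P' W b' ν') ∧
      blumenthalGetoorIndex P' W = blumenthalGetoorIndex P X := by
  obtain ⟨m, _, hm, hm0, hA⟩ := exists_iteratedIntegral_eq X k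
  exact h.exists_of_isInducedBy hX hW hm hm0 fun ω h1 h2 => by
    simp [quasiAverage, hA ω h1 h2 1]

/-- Each round is a one-fold average of the previous clock, so the induction must carry along both
its subordinator property and its characteristics. -/
lemma HasCharacteristics.exists_of_isAveragedInduced (h : HasCharacteristics P X b ν)
    (hX : IsLevySubordinator P X) {k : ℕ} (hW : IsAveragedInduced P X k P' W) :
    IsLevySubordinator P' W ∧ (∃ b' ν', HasCharacteristics P' W b' ν') ∧
      blumenthalGetoorIndex P' W = blumenthalGetoorIndex P X := by
  induction hW with
  | one P' W hW =>
    exact ⟨hW.isLevySubordinator, h.exists_of_repeatedAverage hX (k := 1) hW⟩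
  | succ k P' Y P'' W _ hW ih =>
    obtain ⟨hY, ⟨b', ν', hν'⟩, hBG⟩ := ih
    obtain ⟨h1, h2⟩ := hν'.exists_of_repeatedAverage hY (k := 1) hW
    exact ⟨hW.isLevySubordinator, h1, h2.trans hBG⟩

end Clocks

end RegulatedClock

theorem corollary1 {Ω : Type u} [MeasurableSpace Ω] (P : Measure Ω) (X : ℝ≥0 → Ω → ℝ)
    (hX : RegulatedClock.IsLevySubordinator P X)
    (b : ℝ) (ν : Measure ℝ) (hν : RegulatedClock.HasCharacteristics P X b ν)
    (n : ℝ) (hn : 0 < n)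
    {Ω' : Type v} [MeasurableSpace Ω'] (P' : Measure Ω') (W : ℝ≥0 → Ω' → ℝ) :
    (RegulatedClock.IsTypeIClock P X n P' W →
      (∃! ν' : Measure ℝ, RegulatedClock.IsLevyMeasure P' W ν') ∧
      RegulatedClock.blumenthalGetoorIndex P' W = RegulatedClock.blumenthalGetoorIndex P X) ∧
    (RegulatedClock.IsTypeIIClock P X n P' W →
      (∃! ν' : Measure ℝ, RegulatedClock.IsLevyMeasure P' W ν') ∧
      RegulatedClock.blumenthalGetoorIndex P' W = RegulatedClock.blumenthalGetoorIndex P X) ∧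
    (RegulatedClock.IsTypeIIIClock P X n P' W →
      (∃! ν' : Measure ℝ, RegulatedClock.IsLevyMeasure P' W ν') ∧
      RegulatedClock.blumenthalGetoorIndex P' W = RegulatedClock.blumenthalGetoorIndex P X) := by
  have conclude : (∃ b' ν', RegulatedClock.HasCharacteristics P' W b' ν') ∧
      RegulatedClock.blumenthalGetoorIndex P' W = RegulatedClock.blumenthalGetoorIndex P X →
      (∃! ν' : Measure ℝ, RegulatedClock.IsLevyMeasure P' W ν') ∧
      RegulatedClock.blumenthalGetoorIndex P' W = RegulatedClock.blumenthalGetoorIndex P X :=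
    fun ⟨⟨_, _, hW⟩, hBG⟩ => ⟨hW.existsUnique, hBG⟩
  refine ⟨fun hW => conclude ?_, fun hW => conclude ?_, fun hW => conclude ?_⟩
  -- Lévy measure and index depend only on the law at time 1, so each description is used only
  -- there, intermediate clocks included.
  · rcases hW.regulated with ⟨k, _, _, hind⟩ | hformula
    · exact hν.exists_of_repeatedAverage hX hind
    · exact hν.exists_of_typeI_laplace hn fun u hu => by simpa using hformula 1 u hu
  · rcases hW.regulated with ⟨k, _, _, hind⟩ | hformula
    · exact (hν.exists_of_isAveragedInduced hX hind).2
    · exact hν.exists_of_typeII_laplace hn fun u hu => by simpa using hformula 1 u hu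
  · rcases hW.regulated with ⟨k, _, _, hind⟩ | hformula
    · exact hν.exists_of_quasiAverage hX hind
    · exact hν.exists_of_typeIII_laplace hn fun u hu => by simpa using hformula 1 u hu
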